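/- Let $\mathcal N_\omega$ be the set of all $x\in\mathbb N^{\mathbb N}$ that are eventually $0$, and let $\overline{\mathcal N}_\omega=\mathcal N_\omega\cup\mathcal N_\omega^{-1}\cup\{e\}$, where $\mathcal N_\omega^{-1}=\{x^{-1}:x\in\mathcal N_\omega\}$ is a disjoint copy of $\mathcal N_\omega$, $(x^{-1})^{-1}=x$, $e\notin\mathcal N_\omega\cup\mathcal N_\omega^{-1}$ and $e^{-1}=e$. Equip $\overline{\mathcal N}_\omega$ with the metric $d$ given by $d(x^{-1},y^{-1})=d(x,y)=\max\{2^{-n}:x(n)\ne y(n)\}$ for distinct $x,y\in\mathcal N_\omega$, and $d(x,e)=d(x^{-1},e)=d(x,y^{-1})=1$ for all $x,y\in\mathcal N_\omega$. A *scale* on $\mathcal N_\omega$ is a function $\Gamma:\overline{\mathcal N}_\omega\times[0,\infty)\to[0,\infty)$ such that for all $x$ and $r$: $\Gamma(e,r)=r$; $\Gamma(x,r)\ge r$; $\Gamma(x,r)=0$ iff $r=0$; $\Gamma(x,\cdot)$ is non-decreasing; and $\lim_{r\to0}\Gamma(x,r)=0$. It is *trivial* if $\Gamma(x,r)=r$ for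 all $x\in\overline{\mathcal N}_\omega$ and $r\ge0$. It is *adequate* if for all $x,y,z\in\overline{\mathcal N}_\omega$ and $r_1,r_2\ge0$ $$\min\{\Gamma(x,r_1),\Gamma(z,r_1)\}+d(x,z)+\min\{\Gamma(y,r_2),\Gamma(z,r_2)\}+d(y,z)\ge\min\{\Gamma(x,r_1+r_2),\Gamma(y,r_1+r_2)\}+d(x,y),$$ and, with $r=r_1+\min\{\Gamma(y^{-1},r_2),\Gamma(z^{-1},r_2)\}+d(y,z)$, $$\min\{\Gamma(x,r),\Gamma(z,r)\}+d(x,z)\ge\min\{\Gamma(x,r_1),\Gamma(y,r_1)\}+d(x,y)+r_2.$$ A *match* on a finite interval $I$ of integers is an involution $\theta$ of $I$ with no $i,j\in I$ such that $i<j<\theta(i)<\theta(j)$. For a word $w$ of length $l+1$ over $\overline{\mathcal N}_\omega$ and a match $\theta$ on the positions $0,\dots,l$ of $w$, define $N_\Gamma^\theta(w)\ge0$ recursively (restricting $\theta$ to subwords): $N_\Gamma^\theta(x)=d(e,x)$ for a single letter; $N_\Gamma^\theta(x^{-1}y)=d(x,y)$ if $l=1$ and $\theta(0)=1$; if $\theta(0)=k<l$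 and $w=w_1w_2$ with $w_1$ of length $k+1$, then $N_\Gamma^\theta(w)=N_\Gamma^\theta(w_1)+N_\Gamma^\theta(w_2)$; if $l>1$, $\theta(0)=l$ and $w=x^{-1}w_1y$ with letters $x,y$, then $N_\Gamma^\theta(w)=d(x,y)+\min\{\Gamma(x,N_\Gamma^\theta(w_1)),\Gamma(y,N_\Gamma^\theta(w_1))\}$. For an element $g$ of the free group $F(\mathcal N_\omega)$ let $N_\Gamma(g)$ be the infimum of $N_\Gamma^\theta(w)$ over all words $w$ over $\overline{\mathcal N}_\omega$ representing $g$ (where $e$ represents the identity) and all matches $\theta$ on the positions of $w$. Put $\delta_\Gamma(g,h)=N_\Gamma(g^{-1}h)$ and $\Delta_\Gamma(g,h)=\max\{\delta_\Gamma(g,h),\delta_\Gamma(g^{-1},h^{-1})\}$, and let $\overline F_\Gamma(\mathcal N_\omega)$ be the completion of $(F(\mathcal N_\omega),\Delta_\Gamma)$, which is a Polish group under the continuous extension of the operations of $F(\mathcal N_\omega)$. A Polish group is *CLI* if it admits a compatible complete left-invariant metric. **Theorem.** If $\Gamma$ is a non-trivial adequate scale on $\mathcal N_\omega$, then $\overline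 F_\Gamma(\mathcal N_\omega)$ is not a CLI group. -/

import Mathlib

open scoped NNReal Topology
open Filter

/-- The alphabet `X ∪ X⁻¹ ∪ {e}`. -/
inductive Letter (X : Type*) : Type _
  | e : Letter X
  | pos (x : X) : Letter X
  | neg (x : X) : Letter X

namespace Letter

/-- Formal inverse of letters: `(x⁻¹)⁻¹ = x` and `e⁻¹ = e`. -/
instance {X : Type*} : InvolutiveInv (Letter X) where
  inv a := match a with
    | e => e
    | pos x => neg x
    | neg x => pos x
  inv_inv a := by cases a <;> rfl

/-- The element of the free group represented by a letter. -/
def toFree {X : Type*} : Letter X → FreeGroup X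
  | e => 1
  | pos x => FreeGroup.of x
  | neg x => (FreeGroup.of x)⁻¹

theorem toFree_inv {X : Type*} (a : Letter X) : a⁻¹.toFree = a.toFree⁻¹ := by
  cases a
  · exact inv_one.symm
  · rfl
  · exact (inv_inv _).symm

theorem inv_e {X : Type*} : (e : Letter X)⁻¹ = e := rfl

end Letter

/-- A metric on the alphabet `X ∪ X⁻¹ ∪ {e}` with `d (x⁻¹, y⁻¹) = d (x, y)`. -/
class LetterMetric (X : Type*) extends MetricSpace (Letter X) where
  dist_inv_inv' : ∀ x y : Letter X, dist x⁻¹ y⁻¹ = dist x y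

/-- A scale on the alphabet of `X`. -/
structure Scale (X : Type*) where
  /-- The underlying function. -/
  toFun : Letter X → ℝ≥0 → ℝ≥0
  map_e : ∀ r, toFun Letter.e r = r
  le_map : ∀ x r, r ≤ toFun x r
  map_eq_zero_iff : ∀ x r, toFun x r = 0 ↔ r = 0
  mono : ∀ x, Monotone (toFun x)
  tendsto_zero : ∀ x, Tendsto (toFun x) (𝓝 0) (𝓝 0)

instance {X : Type*} : CoeFun (Scale X) (fun _ => Letter X → ℝ≥0 → ℝ≥0) := ⟨Scale.toFun⟩

/-- `θ` is a match on the `n` consecutive positions `a, …, a + n - 1`: an involution of this set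
with no crossing. Only the values of `θ` on this set matter. -/
def IsMatch (θ : ℕ → ℕ) (a n : ℕ) : Prop :=
  (∀ i, a ≤ i → i < a + n → a ≤ θ i ∧ θ i < a + n) ∧
  (∀ i, a ≤ i → i < a + n → θ (θ i) = i) ∧
  ¬ ∃ i j, a ≤ i ∧ i < a + n ∧ a ≤ j ∧ j < a + n ∧ i < j ∧ j < θ i ∧ θ i < θ j

section PreNorm

variable {X : Type*} [LetterMetric X]

/-- The pre-norm, with respect to `θ`, of the word whose letters are
`w a, w (a + 1), …, w (a + n - 1)`, where `θ` is a match on these positions. In the second case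
of the recursion, the first position `a` is matched with `a + k`: the word is cut after
position `a + k` if this is not the last position; otherwise its first letter is `x⁻¹` with
`x = (w a)⁻¹`, its last letter is `y`, and the word strictly between them is `w₁`. -/
noncomputable def preNorm (Γ : Scale X) (w : ℕ → Letter X) (θ : ℕ → ℕ) (a : ℕ) : ℕ → ℝ≥0
  | 0 => 0
  | 1 => nndist Letter.e (w a)
  | n + 2 =>
    if θ a - a < n + 1 then
      preNorm Γ w θ a (θ a - a + 1) + preNorm Γ w θ (a + (θ a - a) + 1) (n + 1 - (θ a - a))
    else if n = 0 then nndist (w a)⁻¹ (w (a + 1))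
    else nndist (w a)⁻¹ (w (a + n + 1)) +
      min (Γ (w a)⁻¹ (preNorm Γ w θ (a + 1) n)) (Γ (w (a + n + 1)) (preNorm Γ w θ (a + 1) n))
  termination_by n => n

/-- The norm of an element of the free group: the infimum of the pre-norms of the words (lists of
letters, trivial extensions allowed) representing it. The empty word, which has pre-norm `0` like
the one-letter word `e`, does not change the infimum. -/
noncomputable def scaleNorm (Γ : Scale X) (g : FreeGroup X) : ℝ≥0 :=
  sInf {r | ∃ (u : List (Letter X)) (θ : ℕ → ℕ), (u.map Letter.toFree).prod = g ∧
    IsMatch θ 0 u.length ∧ preNorm Γ (fun i => u.getD i Letter.e) θ 0 u.length = r}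

end PreNorm

/-! ### Basic facts on matches and pre-norms -/

theorem prod_toFree_reverse {X : Type*} (u : List (Letter X)) :
    ((u.reverse.map (·⁻¹)).map Letter.toFree).prod = (u.map Letter.toFree).prod⁻¹ := by
  induction u with
  | nil => simp
  | cons a u ih => simp_all [Letter.toFree_inv]

theorem exists_word {X : Type*} (g : FreeGroup X) :
    ∃ u : List (Letter X), (u.map Letter.toFree).prod = g := by
  induction g using FreeGroup.induction_on with
  | C1 => exact ⟨[], rfl⟩
  | of x => exact ⟨[.pos x], by simp [Letter.toFree]⟩
  | inv_of x _ => exact ⟨[.neg x], by simp [Letter.toFree]⟩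
  | mul g h hg hh =>
    obtain ⟨u, rfl⟩ := hg
    obtain ⟨v, rfl⟩ := hh
    exact ⟨u ++ v, by simp⟩

section PreNormFacts

variable {X : Type*} [LetterMetric X]

theorem preNorm_congr (Γ : Scale X) (w w' : ℕ → Letter X) (θ θ' : ℕ → ℕ) (n : ℕ) :
    ∀ a b : ℕ, (∀ i < n, w' (b + i) = w (a + i)) →
    (∀ i < n, θ' (b + i) + a = θ (a + i) + b) →
    preNorm Γ w' θ' b n = preNorm Γ w θ a n := by
  induction n using Nat.strong_induction_on with
  | _ n ih =>
    intro a b hw hθ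
    match n, ih, hw, hθ with
    | 0, _, _, _ => simp [preNorm]
    | 1, _, hw, _ => simpa [preNorm] using congrArg (nndist Letter.e) (hw 0 (by omega))
    | n + 2, ih, hw, hθ =>
      have hk : θ' b - b = θ a - a := by
        have := hθ 0 (by omega); simp only [add_zero] at this; omega
      have h0 : w' b = w a := hw 0 (by omega)
      have h1 : w' (b + n + 1) = w (a + n + 1) := hw (n + 1) (by omega)
      have h2 : w' (b + 1) = w (a + 1) := hw 1 (by omega)
      rw [preNorm, preNorm, hk, h0, h1, h2]
      by_cases hlt : θ a - a < n + 1
      · rw [if_pos hlt, if_pos hlt, ih _ (by omega) a b (fun i hi => hw i (by omega))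
          (fun i hi => hθ i (by omega)),
          ih _ (by omega) (a + (θ a - a) + 1) (b + (θ a - a) + 1)]
        · intro i hi
          have := hw (θ a - a + 1 + i) (by omega)
          convert this using 2 <;> omega
        · intro i hi
          have := hθ (θ a - a + 1 + i) (by omega)
          rw [show b + (θ a - a) + 1 + i = b + (θ a - a + 1 + i) by omega,
            show a + (θ a - a) + 1 + i = a + (θ a - a + 1 + i) by omega]
          omega
      · rw [if_neg hlt, if_neg hlt, ih n (by omega) (a + 1) (b + 1)]
        · intro i hi
          have := hw (1 + i) (by omega)
          convert this using 2 <;> omega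
        · intro i hi
          have := hθ (1 + i) (by omega)
          rw [show b + 1 + i = b + (1 + i) by omega, show a + 1 + i = a + (1 + i) by omega]
          omega

theorem preNorm_split (Γ : Scale X) (w : ℕ → Letter X) (θ : ℕ → ℕ) (a m : ℕ)
    (h : θ a - a < m) : preNorm Γ w θ a m =
      preNorm Γ w θ a (θ a - a + 1) + preNorm Γ w θ (a + (θ a - a) + 1) (m - (θ a - a + 1)) := by
  by_cases hm : θ a - a + 1 = m
  · rw [hm, Nat.sub_self]; simp [preNorm]
  · obtain ⟨n, rfl⟩ : ∃ n, m = n + 2 := ⟨m - 2, by omega⟩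
    conv_lhs => rw [preNorm]
    rw [if_pos (by omega), show n + 2 - (θ a - a + 1) = n + 1 - (θ a - a) by omega]

theorem preNorm_nest (Γ : Scale X) (w : ℕ → Letter X) (θ : ℕ → ℕ) (a n : ℕ)
    (h : θ a = a + n + 1) : preNorm Γ w θ a (n + 2) = nndist (w a)⁻¹ (w (a + n + 1)) +
      min (Γ (w a)⁻¹ (preNorm Γ w θ (a + 1) n)) (Γ (w (a + n + 1)) (preNorm Γ w θ (a + 1) n)) := by
  rw [preNorm, if_neg (by omega)]
  split_ifs with hn
  · subst hn
    have h0 : preNorm Γ w θ (a + 1) 0 = 0 := by rw [preNorm]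
    rw [h0, (Γ.map_eq_zero_iff _ _).2 rfl, (Γ.map_eq_zero_iff _ _).2 rfl]
    simp
  · rfl

theorem IsMatch.after {θ : ℕ → ℕ} {a m : ℕ} (h : IsMatch θ a m) (hm : 0 < m) :
    IsMatch θ (a + (θ a - a) + 1) (m - (θ a - a + 1)) := by
  obtain ⟨h1, h2, h3⟩ := h
  have ha := h1 a le_rfl (by omega)
  have haa := h2 a le_rfl (by omega)
  refine ⟨fun i hi hi' => ?_, fun i hi hi' => h2 i (by omega) (by omega), ?_⟩
  · have hi1 := h1 i (by omega) (by omega)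
    have hi2 := h2 i (by omega) (by omega)
    refine ⟨?_, by omega⟩
    by_contra hc
    have e1 : θ i ≠ a := fun e => by rw [e] at hi2; omega
    have e2 : θ i ≠ θ a := fun e => by rw [e, haa] at hi2; omega
    exact h3 ⟨a, θ i, by omega, by omega, by omega, by omega, by omega, by omega, by omega⟩
  · rintro ⟨i, j, q1, q2, q3, q4, q5, q6, q7⟩
    exact h3 ⟨i, j, by omega, by omega, by omega, by omega, q5, q6, q7⟩

theorem IsMatch.first {θ : ℕ → ℕ} {a m : ℕ} (h : IsMatch θ a m) (hm : 0 < m) :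
    IsMatch θ a (θ a - a + 1) := by
  obtain ⟨h1, h2, h3⟩ := h
  have ha := h1 a le_rfl (by omega)
  have haa := h2 a le_rfl (by omega)
  refine ⟨fun i hi hi' => ?_, fun i hi hi' => h2 i (by omega) (by omega), ?_⟩
  · have hi1 := h1 i (by omega) (by omega)
    have hi2 := h2 i (by omega) (by omega)
    refine ⟨by omega, ?_⟩
    by_contra hc
    have e1 : i ≠ a := fun e => by rw [e] at hc; omega
    have e2 : i ≠ θ a := fun e => by rw [e, haa] at hc; omega
    exact h3 ⟨a, i, by omega, by omega, by omega, by omega, by omega, by omega, by omega⟩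
  · rintro ⟨i, j, q1, q2, q3, q4, q5, q6, q7⟩
    exact h3 ⟨i, j, by omega, by omega, by omega, by omega, q5, q6, q7⟩

theorem IsMatch.inner {θ : ℕ → ℕ} {a n : ℕ} (h : IsMatch θ a (n + 2)) (ha : θ a = a + n + 1) :
    IsMatch θ (a + 1) n := by
  obtain ⟨h1, h2, h3⟩ := h
  have haa := h2 a le_rfl (by omega)
  refine ⟨fun i hi hi' => ?_, fun i hi hi' => h2 i (by omega) (by omega), ?_⟩
  · have hi1 := h1 i (by omega) (by omega)
    have hi2 := h2 i (by omega) (by omega)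
    have e1 : θ i ≠ a := fun e => by rw [e] at hi2; omega
    have e2 : θ i ≠ θ a := fun e => by rw [e, haa] at hi2; omega
    omega
  · rintro ⟨i, j, q1, q2, q3, q4, q5, q6, q7⟩
    exact h3 ⟨i, j, by omega, by omega, by omega, by omega, q5, q6, q7⟩

theorem preNorm_concat (Γ : Scale X) (w : ℕ → Letter X) (θ : ℕ → ℕ) (n m : ℕ) :
    ∀ a, IsMatch θ a m →
      preNorm Γ w θ a (m + n) = preNorm Γ w θ a m + preNorm Γ w θ (a + m) n := by
  induction m using Nat.strong_induction_on with
  | _ m ih =>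
    intro a h
    rcases Nat.eq_zero_or_pos m with rfl | hm
    · simp [preNorm]
    · have ha := h.1 a le_rfl (by omega)
      rw [preNorm_split Γ w θ a m (by omega), preNorm_split Γ w θ a (m + n) (by omega),
        show m + n - (θ a - a + 1) = (m - (θ a - a + 1)) + n by omega,
        ih _ (by omega) _ (h.after hm), add_assoc,
        show a + (θ a - a + 1) + (m - (θ a - a + 1)) = a + m by omega,
        add_assoc (preNorm Γ w θ a (θ a - a + 1))]

/-- The possible values of the pre-norm of a word, generated inductively. -/
inductive PreNormValue (Γ : Scale X) : List (Letter X) → ℝ≥0 → Prop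
  | nil : PreNormValue Γ [] 0
  | single (x : Letter X) : PreNormValue Γ [x] (nndist Letter.e x)
  | append {u v : List (Letter X)} {r s : ℝ≥0} (hu : PreNormValue Γ u r)
      (hv : PreNormValue Γ v s) : PreNormValue Γ (u ++ v) (r + s)
  | nest {u : List (Letter X)} {r : ℝ≥0} (x y : Letter X) (hu : PreNormValue Γ u r) :
      PreNormValue Γ (x⁻¹ :: (u ++ [y])) (nndist x y + min (Γ x r) (Γ y r))

theorem preNormValue_of_match (Γ : Scale X) (w : ℕ → Letter X) (θ : ℕ → ℕ) (n : ℕ) :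
    ∀ a, IsMatch θ a n →
      PreNormValue Γ ((List.range' a n).map w) (preNorm Γ w θ a n) := by
  induction n using Nat.strong_induction_on with
  | _ n ih =>
    intro a h
    match n, ih, h with
    | 0, _, _ => simpa [preNorm] using PreNormValue.nil
    | 1, _, _ => simpa [preNorm] using PreNormValue.single (w a)
    | n + 2, ih, h =>
      have ha := h.1 a le_rfl (by omega)
      by_cases hlt : θ a - a < n + 1
      · rw [preNorm_split Γ w θ a (n + 2) (by omega)]
        have h1 := ih _ (by omega) a (h.first (by omega))
        have h2 := ih _ (by omega) _ (h.after (by omega))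
        have := h1.append h2
        rw [← List.map_append, add_assoc a (θ a - a) 1, List.range'_append_1,
          show θ a - a + 1 + (n + 2 - (θ a - a + 1)) = n + 2 by omega] at this
        rwa [add_assoc a (θ a - a) 1]
      · have ha' : θ a = a + n + 1 := by omega
        rw [preNorm_nest Γ w θ a n ha']
        have := (ih n (by omega) _ (h.inner ha')).nest (w a)⁻¹ (w (a + n + 1))
        rw [inv_inv] at this
        have e : List.range' a (n + 2) = a :: (List.range' (a + 1) n ++ [a + n + 1]) := by
          rw [List.range'_succ, List.range'_1_concat]
          congr 3
          omega
        rw [e]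
        simpa using this

theorem PreNormValue.exists_match {Γ : Scale X} {u : List (Letter X)} {r : ℝ≥0}
    (h : PreNormValue Γ u r) : ∃ θ : ℕ → ℕ, IsMatch θ 0 u.length ∧
      preNorm Γ (fun i => u.getD i Letter.e) θ 0 u.length = r := by
  induction h with
  | nil => exact ⟨id, ⟨by simp, by simp, by simp⟩, by simp [preNorm]⟩
  | single x =>
    refine ⟨id, ⟨by simp, by simp, ?_⟩, by simp [preNorm]⟩
    rintro ⟨i, j, h⟩
    simp at h
    omega
  | @append u v r s _ _ hu hv =>
    obtain ⟨θ₁, ⟨a1, a2, a3⟩, rfl⟩ := hu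
    obtain ⟨θ₂, ⟨b1, b2, b3⟩, rfl⟩ := hv
    simp only [zero_le, true_and, zero_add, forall_const] at a1 a2 a3 b1 b2 b3
    set m := u.length with hm
    set n := v.length with hn
    let θ : ℕ → ℕ := fun i => if i < m then θ₁ i else θ₂ (i - m) + m
    have t1 : ∀ i, i < m → θ i = θ₁ i := fun i hi => if_pos hi
    have t2 : ∀ i, ¬ i < m → θ i = θ₂ (i - m) + m := fun i hi => if_neg hi
    have hM1 : IsMatch θ 0 m := by
      refine ⟨fun i _ hi => ?_, fun i _ hi => ?_, ?_⟩
      · rw [t1 i (by omega)]; have := a1 i (by omega); omega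
      · have := a1 i (by omega)
        rw [t1 i (by omega), t1 _ this, a2 i (by omega)]
      · rintro ⟨i, j, q1, q2, q3, q4, q5, q6, q7⟩
        rw [t1 i (by omega)] at q6 q7
        rw [t1 j (by omega)] at q7
        exact a3 ⟨i, j, by omega, by omega, q5, q6, q7⟩
    refine ⟨θ, ⟨fun i _ hi => ?_, fun i _ hi => ?_, ?_⟩, ?_⟩
    · rw [List.length_append, ← hm, ← hn] at hi ⊢
      by_cases h : i < m
      · rw [t1 i h]; have := a1 i h; omega
      · rw [t2 i h]; have := b1 (i - m) (by omega); omega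
    · rw [List.length_append, ← hm, ← hn] at hi
      by_cases h : i < m
      · rw [t1 i h, t1 _ (a1 i h), a2 i h]
      · rw [t2 i h, t2 _ (by omega), Nat.add_sub_cancel, b2 _ (by omega)]; omega
    · rw [List.length_append, ← hm, ← hn]
      rintro ⟨i, j, q1, q2, q3, q4, q5, q6, q7⟩
      by_cases h : i < m
      · have hi := a1 i h
        rw [t1 i h] at q6 q7
        rw [t1 j (by omega)] at q7
        exact a3 ⟨i, j, by omega, by omega, q5, q6, q7⟩
      · rw [t2 i h] at q6 q7
        rw [t2 j (by omega)] at q7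
        exact b3 ⟨i - m, j - m, by omega, by omega, by omega, by omega, by omega⟩
    · rw [List.length_append, ← hm, ← hn, preNorm_concat Γ _ θ n m 0 hM1]
      congr 1
      · refine preNorm_congr Γ _ _ _ _ _ _ _ (fun i hi => ?_) (fun i hi => ?_)
        · simp only [zero_add]
          rw [List.getD_append _ _ _ _ (by omega)]
        · simp only [zero_add]; rw [t1 i hi]
      · refine preNorm_congr Γ _ _ _ _ _ _ _ (fun i hi => ?_) (fun i hi => ?_)
        · simp only [zero_add]
          rw [List.getD_append_right _ _ _ _ (by omega)]
          congr 1; omega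
        · simp only [zero_add]; rw [t2 _ (by omega)]
          rw [Nat.add_sub_cancel_left]; omega
  | @nest u r x y _ hu =>
    obtain ⟨θ₁, ⟨a1, a2, a3⟩, rfl⟩ := hu
    simp only [zero_le, true_and, zero_add, forall_const] at a1 a2 a3
    set m := u.length with hm
    have hl : (x⁻¹ :: (u ++ [y])).length = m + 2 := by simp [hm]
    let θ : ℕ → ℕ := fun i => if i = 0 then m + 1 else if i = m + 1 then 0 else θ₁ (i - 1) + 1
    have t0 : θ 0 = m + 1 := rfl
    have t1 : θ (m + 1) = 0 := by simp [θ]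
    have t2 : ∀ i, i ≠ 0 → i ≠ m + 1 → θ i = θ₁ (i - 1) + 1 := fun i h h' => by
      simp only [θ]; rw [if_neg h, if_neg h']
    rw [hl]
    refine ⟨θ, ⟨fun i _ hi => ?_, fun i _ hi => ?_, ?_⟩, ?_⟩
    · by_cases h0 : i = 0
      · subst h0; rw [t0]; omega
      by_cases h1 : i = m + 1
      · subst h1; rw [t1]; omega
      rw [t2 i h0 h1]; have := a1 (i - 1) (by omega); omega
    · by_cases h0 : i = 0
      · subst h0; rw [t0, t1]
      by_cases h1 : i = m + 1
      · subst h1; rw [t1, t0]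
      have := a1 (i - 1) (by omega)
      rw [t2 i h0 h1, t2 _ (by omega) (by omega), Nat.add_sub_cancel, a2 _ (by omega)]; omega
    · rintro ⟨i, j, q1, q2, q3, q4, q5, q6, q7⟩
      by_cases h0 : i = 0
      · subst h0; rw [t0] at q6 q7
        rw [t2 j (by omega) (by omega)] at q7
        have := a1 (j - 1) (by omega); omega
      by_cases h1 : i = m + 1
      · omega
      rw [t2 i h0 h1] at q6 q7
      have hj : j ≠ m + 1 := by
        rintro rfl; rw [t1] at q7; omega
      rw [t2 j (by omega) hj] at q7
      exact a3 ⟨i - 1, j - 1, by omega, by omega, by omega, by omega, by omega⟩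
    · rw [preNorm_nest Γ _ θ 0 m (by rw [t0]; omega)]
      have e0 : (x⁻¹ :: (u ++ [y])).getD 0 Letter.e = x⁻¹ := rfl
      have e1 : (x⁻¹ :: (u ++ [y])).getD (0 + m + 1) Letter.e = y := by
        rw [List.getD_cons_succ, List.getD_append_right _ _ _ _ (by omega)]
        simp [hm]
      rw [e0, e1, inv_inv, preNorm_congr Γ (fun i => u.getD i Letter.e) _ θ₁ θ m 0 (0 + 1)]
      · intro i hi
        rw [show 0 + 1 + i = i + 1 by omega, List.getD_cons_succ,
          List.getD_append _ _ _ _ (by omega), zero_add]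
      · intro i hi
        rw [t2 _ (by omega) (by omega), show 0 + 1 + i - 1 = i by omega, zero_add]

theorem PreNormValue.reverse {Γ : Scale X} {u : List (Letter X)} {r : ℝ≥0}
    (h : PreNormValue Γ u r) : PreNormValue Γ (u.reverse.map (·⁻¹)) r := by
  induction h with
  | nil => exact .nil
  | single x =>
    have e : nndist Letter.e x = nndist Letter.e x⁻¹ := by
      apply NNReal.coe_injective
      rw [coe_nndist, coe_nndist, ← LetterMetric.dist_inv_inv' Letter.e x, Letter.inv_e]
    rw [e]
    exact .single x⁻¹
  | append _ _ hu hv =>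
    rw [List.reverse_append, List.map_append, add_comm]
    exact hv.append hu
  | nest x y _ hu =>
    have := hu.nest y x
    rw [nndist_comm, min_comm] at this
    simpa using this

theorem exists_preNormValue (Γ : Scale X) (u : List (Letter X)) : ∃ r, PreNormValue Γ u r := by
  induction u with
  | nil => exact ⟨0, .nil⟩
  | cons a u ih =>
    obtain ⟨r, hr⟩ := ih
    exact ⟨_, (PreNormValue.single a).append hr⟩

theorem scaleNorm_le {Γ : Scale X} {u : List (Letter X)} {r : ℝ≥0} (h : PreNormValue Γ u r) :
    scaleNorm Γ (u.map Letter.toFree).prod ≤ r := by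
  obtain ⟨θ, h1, h2⟩ := h.exists_match
  exact csInf_le (OrderBot.bddBelow _) ⟨u, θ, rfl, h1, h2⟩

theorem exists_lt_of_scaleNorm_lt {Γ : Scale X} {g : FreeGroup X} {t : ℝ≥0}
    (h : scaleNorm Γ g < t) :
    ∃ u r, (u.map Letter.toFree).prod = g ∧ PreNormValue Γ u r ∧ r < t := by
  obtain ⟨u₀, hu₀⟩ := exists_word g
  obtain ⟨r₀, hr₀⟩ := exists_preNormValue Γ u₀
  obtain ⟨θ₀, h1, h2⟩ := hr₀.exists_match
  obtain ⟨_, ⟨u, θ, q1, q2, rfl⟩, hlt⟩ := exists_lt_of_csInf_lt (by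
    exact ⟨r₀, u₀, θ₀, hu₀, h1, h2⟩) h
  refine ⟨u, _, q1, ?_, hlt⟩
  have := preNormValue_of_match Γ (fun i => u.getD i Letter.e) θ u.length 0 q2
  convert this
  apply List.ext_getElem
  · simp
  · intro i hi hi'
    simp [hi]

theorem scaleNorm_one (Γ : Scale X) : scaleNorm Γ (1 : FreeGroup X) = 0 :=
  le_antisymm (scaleNorm_le (Γ := Γ) PreNormValue.nil) (zero_le)

theorem scaleNorm_inv_le (Γ : Scale X) (g : FreeGroup X) : scaleNorm Γ g⁻¹ ≤ scaleNorm Γ g := by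
  refine le_of_forall_gt fun t ht => ?_
  obtain ⟨u, r, rfl, hu, hr⟩ := exists_lt_of_scaleNorm_lt ht
  rw [← prod_toFree_reverse]
  exact (scaleNorm_le hu.reverse).trans_lt hr

theorem scaleNorm_inv (Γ : Scale X) (g : FreeGroup X) : scaleNorm Γ g⁻¹ = scaleNorm Γ g :=
  le_antisymm (scaleNorm_inv_le Γ g) (by simpa using scaleNorm_inv_le Γ g⁻¹)

theorem scaleNorm_mul_le (Γ : Scale X) (g h : FreeGroup X) :
    scaleNorm Γ (g * h) ≤ scaleNorm Γ g + scaleNorm Γ h := by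
  refine le_of_forall_pos_le_add fun ε hε => ?_
  have hε' : 0 < ε / 2 := by positivity
  obtain ⟨u, r, rfl, hu, hr⟩ := exists_lt_of_scaleNorm_lt (lt_add_of_pos_right (scaleNorm Γ g) hε')
  obtain ⟨v, s, rfl, hv, hs⟩ := exists_lt_of_scaleNorm_lt (lt_add_of_pos_right (scaleNorm Γ h) hε')
  rw [← List.prod_append, ← List.map_append]
  refine (scaleNorm_le (hu.append hv)).trans ((add_lt_add hr hs).le.trans_eq ?_)
  rw [add_add_add_comm, add_halves]

theorem scaleNorm_conj_letter (Γ : Scale X) (x : Letter X) {ε : ℝ≥0} (hε : 0 < ε) :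
    ∃ δ > 0, ∀ h, scaleNorm Γ h < δ → scaleNorm Γ (x.toFree⁻¹ * h * x.toFree) < ε := by
  obtain ⟨δ, hδ, H⟩ := Metric.tendsto_nhds_nhds.1 (Γ.tendsto_zero x) ε (by exact_mod_cast hε)
  refine ⟨⟨δ, hδ.le⟩, hδ, fun h hh => ?_⟩
  obtain ⟨u, r, rfl, hu, hr⟩ := exists_lt_of_scaleNorm_lt hh
  have h1 := scaleNorm_le (hu.nest x x)
  have h2 : ((x⁻¹ :: (u ++ [x])).map Letter.toFree).prod =
      x.toFree⁻¹ * (u.map Letter.toFree).prod * x.toFree := by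
    simp [Letter.toFree_inv, mul_assoc]
  rw [h2, nndist_self, min_self, zero_add] at h1
  refine h1.trans_lt ?_
  have h3 := @H r (by rw [NNReal.dist_eq, NNReal.coe_zero, sub_zero, NNReal.abs_eq]; exact hr)
  rw [NNReal.dist_eq, NNReal.coe_zero, sub_zero, NNReal.abs_eq] at h3
  exact_mod_cast h3

theorem scaleNorm_conj (Γ : Scale X) (g : FreeGroup X) :
    ∀ ε : ℝ≥0, 0 < ε → ∃ δ > 0, ∀ h, scaleNorm Γ h < δ → scaleNorm Γ (g⁻¹ * h * g) < ε := by
  induction g using FreeGroup.induction_on with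
  | C1 => exact fun ε hε => ⟨ε, hε, fun h hh => by simpa using hh⟩
  | of x => exact fun ε hε => scaleNorm_conj_letter Γ (.pos x) hε
  | inv_of x _ => exact fun ε hε => scaleNorm_conj_letter Γ (.neg x) hε
  | mul g k hg hk =>
    intro ε hε
    obtain ⟨δ, hδ, H⟩ := hk ε hε
    obtain ⟨δ', hδ', H'⟩ := hg δ hδ
    refine ⟨δ', hδ', fun h hh => ?_⟩
    have := H _ (H' h hh)
    simpa [mul_assoc] using this

end PreNormFacts

/-! ### The metrics on the free group and the completion -/

section Completion

variable {X : Type*} [LetterMetric X]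

/-- The left-invariant distance `δ_Γ` on the free group. -/
noncomputable def scaleDelta (Γ : Scale X) (g h : FreeGroup X) : ℝ := scaleNorm Γ (g⁻¹ * h)

/-- The free group on `X`, to be equipped with the distance `Δ_Γ`. -/
def ScaledFreeGroup (_Γ : Scale X) : Type _ := FreeGroup X

instance (Γ : Scale X) : Group (ScaledFreeGroup Γ) := inferInstanceAs (Group (FreeGroup X))

instance (Γ : Scale X) [Countable X] : Countable (ScaledFreeGroup Γ) :=
  inferInstanceAs (Countable (FreeGroup X))

theorem scaleDelta_triangle (Γ : Scale X) (a b c : FreeGroup X) :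
    scaleDelta Γ a c ≤ scaleDelta Γ a b + scaleDelta Γ b c := by
  have := scaleNorm_mul_le Γ (a⁻¹ * b) (b⁻¹ * c)
  rw [show a⁻¹ * b * (b⁻¹ * c) = a⁻¹ * c by group] at this
  exact_mod_cast this

theorem scaleDelta_comm (Γ : Scale X) (a b : FreeGroup X) :
    scaleDelta Γ a b = scaleDelta Γ b a := by
  unfold scaleDelta
  rw [← scaleNorm_inv, mul_inv_rev, inv_inv]

theorem scaleDelta_self (Γ : Scale X) (a : FreeGroup X) : scaleDelta Γ a a = 0 := by
  simp [scaleDelta, scaleNorm_one]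

/-- The distance `Δ_Γ (g, h) = max (δ_Γ (g, h)) (δ_Γ (g⁻¹, h⁻¹))`. Separation of points is not
recorded here: it plays no role in the definition of the completion. -/
noncomputable instance (Γ : Scale X) : PseudoMetricSpace (ScaledFreeGroup Γ) where
  dist (g h : FreeGroup X) := max (scaleDelta Γ g h) (scaleDelta Γ g⁻¹ h⁻¹)
  dist_self g := (congrArg₂ max (scaleDelta_self Γ g) (scaleDelta_self Γ _)).trans (max_self 0)
  dist_comm g h := congrArg₂ max (scaleDelta_comm Γ g h) (scaleDelta_comm Γ _ _)
  dist_triangle a b c := by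
    refine max_le ((scaleDelta_triangle Γ a b c).trans ?_)
      ((scaleDelta_triangle Γ _ (b : FreeGroup X)⁻¹ _).trans ?_)
    · exact add_le_add (le_max_left _ _) (le_max_left _ _)
    · exact add_le_add (le_max_right _ _) (le_max_right _ _)

theorem dist_scaled (Γ : Scale X) (g h : ScaledFreeGroup Γ) :
    dist g h = max (scaleNorm Γ (g⁻¹ * h) : ℝ) (scaleNorm Γ (g * h⁻¹)) := by
  change max (scaleDelta Γ g h) (scaleDelta Γ (g : FreeGroup X)⁻¹ (h : FreeGroup X)⁻¹) = _
  unfold scaleDelta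
  rw [inv_inv (G := FreeGroup X) g]
  rfl

/-- The completion of the free group on `X` with respect to the distance `Δ_Γ`. -/
def ScaledCompletion (Γ : Scale X) : Type _ := UniformSpace.Completion (ScaledFreeGroup Γ)

namespace ScaledCompletion

variable (Γ : Scale X)

noncomputable instance : MetricSpace (ScaledCompletion Γ) :=
  inferInstanceAs (MetricSpace (UniformSpace.Completion (ScaledFreeGroup Γ)))

instance : CompleteSpace (ScaledCompletion Γ) :=
  inferInstanceAs (CompleteSpace (UniformSpace.Completion (ScaledFreeGroup Γ)))

instance [Countable X] : PolishSpace (ScaledCompletion Γ) :=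
  inferInstanceAs (PolishSpace (UniformSpace.Completion (ScaledFreeGroup Γ)))

/-- The canonical isometric map of the free group to its completion. -/
noncomputable def of (g : ScaledFreeGroup Γ) : ScaledCompletion Γ :=
  UniformSpace.Completion.coe' g

theorem isDenseInducing_of : IsDenseInducing (of Γ) :=
  UniformSpace.Completion.isDenseInducing_coe

theorem isUniformInducing_of : IsUniformInducing (of Γ) :=
  UniformSpace.Completion.isUniformInducing_coe _

theorem isometry_of : Isometry (of Γ) := UniformSpace.Completion.coe_isometry

theorem tendsto_inv (a : ScaledCompletion Γ) :
    ∃ c, Tendsto (fun g => of Γ g⁻¹) (comap (of Γ) (𝓝 a)) (𝓝 c) := by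
  have hinv : UniformContinuous (fun g : ScaledFreeGroup Γ => g⁻¹) := by
    refine (Isometry.of_dist_eq fun g h => ?_).uniformContinuous
    rw [dist_scaled, dist_scaled, inv_inv, inv_inv, max_comm]
  have hne := (isDenseInducing_of Γ).comap_nhds_neBot a
  have hC : Cauchy (comap (of Γ) (𝓝 a)) :=
    cauchy_nhds.comap' (isUniformInducing_of Γ).comap_uniformity.le hne
  exact CompleteSpace.complete ((hC.map hinv).map (isUniformInducing_of Γ).uniformContinuous)

theorem cauchy_mul {F G : Filter (ScaledFreeGroup Γ)} (hF : Cauchy F) (hG : Cauchy G) :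
    Cauchy ((F ×ˢ G).map (fun p => p.1 * p.2)) := by
  -- Products `g * h` with `g`, `h` in small sets vary little for the left distance.
  have key : ∀ F G : Filter (ScaledFreeGroup Γ), Cauchy F → Cauchy G → ∀ ε : ℝ≥0, 0 < ε →
      ∃ s ∈ F, ∃ t ∈ G, ∀ g ∈ s, ∀ g' ∈ s, ∀ h ∈ t, ∀ h' ∈ t,
        scaleNorm Γ ((g * h)⁻¹ * (g' * h')) < ε := by
    intro F G hF hG ε hε
    have hε3 : 0 < ε / 3 := by positivity
    obtain ⟨t, ht, Ht⟩ := (Metric.cauchy_iff.1 hG).2 (ε / 3 : ℝ≥0) (by exact_mod_cast hε3)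
    have := hG.1
    obtain ⟨h₀, hh₀⟩ := this.nonempty_of_mem ht
    obtain ⟨δ, hδ, H⟩ := scaleNorm_conj Γ h₀ (ε / 3) hε3
    obtain ⟨s, hs, Hs⟩ := (Metric.cauchy_iff.1 hF).2 (δ : ℝ≥0) (by exact_mod_cast hδ)
    have small : ∀ {η : ℝ≥0} {a b : ScaledFreeGroup Γ}, dist a b < η →
        scaleNorm Γ (a⁻¹ * b) < η := by
      intro η a b hab
      rw [dist_scaled] at hab
      exact_mod_cast (le_max_left _ _).trans_lt hab
    refine ⟨s, hs, t, ht, fun g hg g' hg' h hh h' hh' => ?_⟩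
    have e : (g * h)⁻¹ * (g' * h') =
        (h⁻¹ * h₀) * (h₀⁻¹ * (g⁻¹ * g') * h₀) * (h₀⁻¹ * h') := by group
    rw [e]
    have i1 := small (Ht h hh h₀ hh₀)
    have i2 := H _ (small (Hs g hg g' hg'))
    have i3 := small (Ht h₀ hh₀ h' hh')
    calc _ ≤ _ := scaleNorm_mul_le Γ _ _
      _ ≤ _ := add_le_add_left (scaleNorm_mul_le Γ _ _) _
      _ < ε / 3 + ε / 3 + ε / 3 := add_lt_add (add_lt_add i1 i2) i3
      _ = ε := by
        apply NNReal.coe_injective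
        push_cast
        ring
  have hinv : UniformContinuous (fun g : ScaledFreeGroup Γ => g⁻¹) := by
    refine (Isometry.of_dist_eq fun g h => ?_).uniformContinuous
    rw [dist_scaled, dist_scaled, inv_inv, inv_inv, max_comm]
  have hF1 := hF.1
  have hG1 := hG.1
  refine Metric.cauchy_iff.2 ⟨inferInstance, fun ε hε => ?_⟩
  have hε2 : (0 : ℝ≥0) < ⟨ε, hε.le⟩ := hε
  obtain ⟨s, hs, t, ht, H⟩ := key F G hF hG _ hε2
  obtain ⟨t', ht', s', hs', H'⟩ := key _ _ (hG.map hinv) (hF.map hinv) _ hε2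
  refine ⟨_, image_mem_map (prod_mem_prod (inter_mem hs hs') (inter_mem ht ht')), ?_⟩
  rintro _ ⟨⟨g, h⟩, ⟨hg, hh⟩, rfl⟩ _ ⟨⟨g', h'⟩, ⟨hg', hh'⟩, rfl⟩
  rw [dist_scaled]
  refine max_lt (H g hg.1 g' hg'.1 h hh.1 h' hh'.1) ?_
  have := H' _ hh.2 _ hh'.2 _ hg.2 _ hg'.2
  rw [show (h⁻¹ * g⁻¹)⁻¹ * (h'⁻¹ * g'⁻¹) = g * h * (g' * h')⁻¹ by group] at this
  exact this

theorem tendsto_mul (p : ScaledCompletion Γ × ScaledCompletion Γ) :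
    ∃ c, Tendsto (fun q : ScaledFreeGroup Γ × ScaledFreeGroup Γ => of Γ (q.1 * q.2))
      (comap (Prod.map (of Γ) (of Γ)) (𝓝 p)) (𝓝 c) := by
  have hC : ∀ a, Cauchy (comap (of Γ) (𝓝 a)) := fun a =>
    cauchy_nhds.comap' (isUniformInducing_of Γ).comap_uniformity.le
      ((isDenseInducing_of Γ).comap_nhds_neBot a)
  obtain ⟨a, b⟩ := p
  rw [nhds_prod_eq, comap_prodMap_prod]
  exact CompleteSpace.complete
    ((cauchy_mul Γ (hC a) (hC b)).map (isUniformInducing_of Γ).uniformContinuous)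

/-- The multiplication is the continuous extension of that of the free group. -/
noncomputable instance : Mul (ScaledCompletion Γ) where
  mul a b := ((isDenseInducing_of Γ).prodMap (isDenseInducing_of Γ)).extend
    (fun q : ScaledFreeGroup Γ × ScaledFreeGroup Γ => of Γ (q.1 * q.2)) (a, b)

/-- The inverse is the continuous extension of that of the free group. -/
noncomputable instance : Inv (ScaledCompletion Γ) where
  inv a := (isDenseInducing_of Γ).extend (fun g => of Γ g⁻¹) a

noncomputable instance : One (ScaledCompletion Γ) := ⟨of Γ 1⟩

instance : ContinuousMul (ScaledCompletion Γ) where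
  continuous_mul := ((isDenseInducing_of Γ).prodMap (isDenseInducing_of Γ)).continuous_extend
    (tendsto_mul Γ)

instance : ContinuousInv (ScaledCompletion Γ) where
  continuous_inv := (isDenseInducing_of Γ).continuous_extend (tendsto_inv Γ)

theorem of_mul (g h : ScaledFreeGroup Γ) : of Γ (g * h) = of Γ g * of Γ h :=
  (((isDenseInducing_of Γ).prodMap (isDenseInducing_of Γ)).extend_eq' (tendsto_mul Γ) (g, h)).symm

theorem of_inv (g : ScaledFreeGroup Γ) : of Γ g⁻¹ = (of Γ g)⁻¹ :=
  ((isDenseInducing_of Γ).extend_eq' (tendsto_inv Γ) g).symm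

theorem of_one : of Γ 1 = 1 := rfl

noncomputable instance : Group (ScaledCompletion Γ) where
  mul_assoc a b c := by
    refine (isDenseInducing_of Γ).dense.induction_on₃ (p := fun a b c => a * b * c = a * (b * c))
      (isClosed_eq (by fun_prop) (by fun_prop)) (fun g h k => ?_) a b c
    rw [← of_mul, ← of_mul, ← of_mul, ← of_mul, mul_assoc]
  one_mul a := by
    refine (isDenseInducing_of Γ).dense.induction_on (p := fun a => 1 * a = a) a
      (isClosed_eq (by fun_prop) (by fun_prop)) fun g => ?_
    rw [← of_one, ← of_mul, one_mul]
  mul_one a := by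
    refine (isDenseInducing_of Γ).dense.induction_on (p := fun a => a * 1 = a) a
      (isClosed_eq (by fun_prop) (by fun_prop)) fun g => ?_
    rw [← of_one, ← of_mul, mul_one]
  inv_mul_cancel a := by
    refine (isDenseInducing_of Γ).dense.induction_on (p := fun a => a⁻¹ * a = 1) a
      (isClosed_eq (by fun_prop) (by fun_prop)) fun g => ?_
    rw [← of_inv, ← of_mul, inv_mul_cancel, of_one]

instance : IsTopologicalGroup (ScaledCompletion Γ) where

end ScaledCompletion

end Completion

/-! ### Adequate scales, CLI groups, and the space of eventually zero sequences -/

/-- The trivial scale is `Γ (x, r) = r`. -/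
def Scale.IsTrivial {X : Type*} (Γ : Scale X) : Prop := ∀ x r, Γ x r = r

/-- Adequate scales: conditions (A1) and (A2). -/
def Scale.IsAdequate {X : Type*} [LetterMetric X] (Γ : Scale X) : Prop :=
  ∀ (x y z : Letter X) (r₁ r₂ : ℝ≥0),
    (min (Γ x (r₁ + r₂)) (Γ y (r₁ + r₂)) + nndist x y ≤
      min (Γ x r₁) (Γ z r₁) + nndist x z + min (Γ y r₂) (Γ z r₂) + nndist y z) ∧
    (∀ r : ℝ≥0, r = r₁ + min (Γ y⁻¹ r₂) (Γ z⁻¹ r₂) + nndist y z →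
      min (Γ x r₁) (Γ y r₁) + nndist x y + r₂ ≤ min (Γ x r) (Γ z r) + nndist x z)

/-- A Polish group is CLI if it admits a compatible complete left-invariant metric. -/
def IsCLI (G : Type*) [Group G] [t : TopologicalSpace G] [IsTopologicalGroup G] [PolishSpace G] :
    Prop :=
  ∃ m : MetricSpace G, m.toUniformSpace.toTopologicalSpace = t ∧
    @CompleteSpace G m.toUniformSpace ∧ ∀ g h k : G, m.dist (g * h) (g * k) = m.dist h k

/-- The set `𝒩_ω` of sequences of natural numbers that are eventually zero. -/
def EventuallyZeroSeq : Type := {x : ℕ → ℕ // ∃ n, ∀ m ≥ n, x m = 0}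

namespace EventuallyZeroSeq

instance : Countable EventuallyZeroSeq := by
  classical
  have hf : ∀ x : EventuallyZeroSeq, (Function.support x.1).Finite := fun x => by
    obtain ⟨n, hn⟩ := x.2
    refine (Set.finite_lt_nat n).subset fun m hm => ?_
    by_contra h
    exact hm (hn m (not_lt.1 h))
  refine Function.Injective.countable
    (f := fun x : EventuallyZeroSeq => Finsupp.ofSupportFinite x.1 (hf x)) fun x y h => ?_
  exact Subtype.ext (congrArg (fun f : ℕ →₀ ℕ => (f : ℕ → ℕ)) h)

open Classical in
/-- The distance on `𝒩_ω`: for `x ≠ y` it is `max {2⁻ⁿ | x n ≠ y n}`, attained at the least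
index `n` where `x` and `y` differ. -/
noncomputable def seqDist (x y : EventuallyZeroSeq) : ℝ :=
  if x = y then 0 else (1 / 2) ^ PiNat.firstDiff x.1 y.1

/-- The distance on the alphabet of `𝒩_ω`: for `x`, `y` in `𝒩_ω`, `d (x⁻¹, y⁻¹) = d (x, y)` and
`d (x, e) = d (x⁻¹, e) = d (x, y⁻¹) = 1`. -/
noncomputable def letterDist : Letter EventuallyZeroSeq → Letter EventuallyZeroSeq → ℝ
  | .e, .e => 0
  | .pos x, .pos y => seqDist x y
  | .neg x, .neg y => seqDist x y
  | _, _ => 1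

theorem seqDist_eq (x y : EventuallyZeroSeq) : seqDist x y = PiNat.dist.dist x.1 y.1 := by
  unfold seqDist
  by_cases h : x = y
  · subst h; rw [if_pos rfl]; exact (PiNat.dist_self _).symm
  · rw [if_neg h, PiNat.dist_eq_of_ne (fun e => h (Subtype.ext e))]

theorem seqDist_triangle (x y z : EventuallyZeroSeq) :
    seqDist x z ≤ seqDist x y + seqDist y z := by
  rw [seqDist_eq, seqDist_eq, seqDist_eq]
  exact PiNat.dist_triangle _ _ _

theorem seqDist_comm (x y : EventuallyZeroSeq) : seqDist x y = seqDist y x := by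
  rw [seqDist_eq, seqDist_eq]
  exact PiNat.dist_comm _ _

theorem seqDist_self (x : EventuallyZeroSeq) : seqDist x x = 0 := if_pos rfl

theorem seqDist_nonneg (x y : EventuallyZeroSeq) : 0 ≤ seqDist x y := by
  rw [seqDist_eq]
  exact PiNat.dist_nonneg _ _

theorem seqDist_le_one (x y : EventuallyZeroSeq) : seqDist x y ≤ 1 := by
  rw [seqDist_eq]
  exact PiNat.dist_le_one _ _

theorem eq_of_seqDist_eq_zero {x y : EventuallyZeroSeq} (h : seqDist x y = 0) : x = y := by
  rw [seqDist_eq] at h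
  exact Subtype.ext (PiNat.eq_of_dist_eq_zero _ _ h)

noncomputable instance : LetterMetric EventuallyZeroSeq where
  dist := letterDist
  dist_self a := by cases a <;> simp [letterDist, seqDist_self]
  dist_comm a b := by
    cases a <;> cases b <;> simp [letterDist] <;> exact seqDist_comm _ _
  dist_triangle a b c := by
    cases a <;> cases b <;> cases c <;> simp only [letterDist] <;>
      first
      | exact seqDist_triangle _ _ _
      | (norm_num; done)
      | (rename_i x y
         have := seqDist_nonneg x y
         have := seqDist_le_one x y
         linarith)
      | (rename_i x y z
         have := seqDist_nonneg x y
         have := seqDist_nonneg y z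
         have := seqDist_nonneg x z
         have := seqDist_le_one x z
         linarith)
  eq_of_dist_eq_zero {a b} h := by
    change letterDist a b = 0 at h
    cases a <;> cases b <;> simp_all [letterDist] <;> exact eq_of_seqDist_eq_zero h
  dist_inv_inv' a b := by
    cases a <;> cases b <;> rfl

end EventuallyZeroSeq

/-! A group is not CLI as soon as it has a sequence that is Cauchy for the left uniformity but does
not converge. Non-triviality of the scale yields such a sequence. Adequacy makes `Γ x` subadditive,
so a strict inequality `R < Γ x R` at one radius propagates down to all small radii: `c * r ≤ Γ x r`
for some letter `x` and some `c > 1` (`Scale.IsAdequate.exists_expanding`). Conjugation by `x` can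
therefore compensate a geometric decay of ratio `c⁻¹`.

Choose letters `z i` at distance comparable to `κ * c⁻¹ ^ i` from `x` and let `g n` be the product
of the `x⁻¹ * z i` for `i < n`. The norm of `(g n)⁻¹ * g (n + 1) = x⁻¹ * z n` is summable in `n`, so
`g` is left Cauchy. If it converged, `g (n + 1) * (g n)⁻¹` would tend to `1`; but this is the
conjugate of `x⁻¹ * z n` by `g n`, and its norm stays at least `κ`.

For the lower bound, adequacy ensures that cancelling a pair of inverse letters does not increase
the cost (`MatchBound.erase`), so only matches of the reduced word `x⁻¹ z₀ x⁻¹ z₁ ⋯ z₁⁻¹ x z₀⁻¹ x`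
matter. A match that is cheap at level `i` must pair the outer `x⁻¹` with the outer `x`, and `z i`
with its inverse. The cost `r` of the inner word then becomes at least `Γ x r`, which regains the
factor `c` at each level (`SeparatedLetters.le_of_matchBound_word`). -/

/-! ### Letters as reduced words, and elementary properties of scales -/

namespace Letter

variable {X : Type*}

/-- The reduced word of a letter: the trivial letter has the empty word. -/
def word : Letter X → List (X × Bool)
  | e => []
  | pos x => [(x, true)]
  | neg x => [(x, false)]

/-- The letter of a generator with a sign. -/
def ofPair : X × Bool → Letter X
  | (x, true) => pos x
  | (x, false) => neg x

theorem word_e : (e : Letter X).word = [] := rfl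

theorem word_ofPair (p : X × Bool) : (ofPair p).word = [p] := by
  obtain ⟨x, _ | _⟩ := p <;> rfl

theorem eq_e_or_ofPair (a : Letter X) : a = e ∨ ∃ p, a = ofPair p := by
  cases a with
  | e => exact .inl rfl
  | pos x => exact .inr ⟨(x, true), rfl⟩
  | neg x => exact .inr ⟨(x, false), rfl⟩

theorem ofPair_inv (x : X) (b : Bool) : (ofPair (x, b))⁻¹ = ofPair (x, !b) := by
  cases b <;> rfl

theorem word_inv (a : Letter X) : a⁻¹.word = FreeGroup.invRev a.word := by
  cases a <;> rfl

theorem toFree_eq_mk (a : Letter X) : a.toFree = FreeGroup.mk a.word := by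
  cases a <;> rfl

theorem toFree_ofPair (p : X × Bool) : (ofPair p).toFree = FreeGroup.mk [p] := by
  rw [toFree_eq_mk, word_ofPair]

variable [LetterMetric X]

theorem nndist_inv_inv' (a b : Letter X) : nndist a⁻¹ b⁻¹ = nndist a b :=
  NNReal.coe_injective (LetterMetric.dist_inv_inv' a b)

theorem nndist_e_inv (a : Letter X) : nndist e a⁻¹ = nndist e a := by
  rw [← nndist_inv_inv' e a, inv_e]

end Letter

open Letter

section Basic

variable {X : Type*}

theorem Scale.map_zero (Γ : Scale X) (x : Letter X) : Γ x 0 = 0 := (Γ.map_eq_zero_iff x 0).2 rfl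

theorem Scale.min_map_e_left (Γ : Scale X) (y : Letter X) (r : ℝ≥0) : min (Γ e r) (Γ y r) = r := by
  rw [Γ.map_e, min_eq_left (Γ.le_map y r)]

theorem Scale.min_map_e_right (Γ : Scale X) (y : Letter X) (r : ℝ≥0) : min (Γ y r) (Γ e r) = r := by
  rw [min_comm, Scale.min_map_e_left]

theorem Scale.le_min_map (Γ : Scale X) (x y : Letter X) (r : ℝ≥0) : r ≤ min (Γ x r) (Γ y r) :=
  le_min (Γ.le_map x r) (Γ.le_map y r)

theorem prod_toFree_eq_mk (u : List (Letter X)) :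
    (u.map Letter.toFree).prod = FreeGroup.mk (u.flatMap word) := by
  induction u with
  | nil => rfl
  | cons a u ih =>
    rw [List.map_cons, List.prod_cons, ih, toFree_eq_mk, FreeGroup.mul_mk, List.flatMap_cons]

end Basic

/-! ### Matches of words without trivial letters, and invariance under free reduction -/

section MatchBound

variable {X : Type*} [LetterMetric X] {Γ : Scale X}

/-- The upper bounds of the pre-norms of a word without trivial letters, where a letter that is
not matched with another one is considered as matched with the trivial letter. -/
inductive MatchBound (Γ : Scale X) : List (X × Bool) → ℝ≥0 → Prop
  | nil (r : ℝ≥0) : MatchBound Γ [] r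
  | append {u v : List (X × Bool)} {r s : ℝ≥0} (hu : MatchBound Γ u r)
      (hv : MatchBound Γ v s) : MatchBound Γ (u ++ v) (r + s)
  | nest {u : List (X × Bool)} {r : ℝ≥0} (x y : Letter X) (hu : MatchBound Γ u r) :
      MatchBound Γ (x⁻¹.word ++ (u ++ y.word)) (nndist x y + min (Γ x r) (Γ y r))

namespace MatchBound

/-- The empty word carries every bound, so appending it absorbs the slack `s - r`. -/
theorem mono {u : List (X × Bool)} {r s : ℝ≥0} (h : MatchBound Γ u r) (hrs : r ≤ s) :
    MatchBound Γ u s := by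
  have := h.append (.nil (s - r))
  rwa [List.append_nil, add_tsub_cancel_of_le hrs] at this

theorem single (x : Letter X) : MatchBound Γ x.word (nndist e x) := by
  have := (MatchBound.nil (Γ := Γ) 0).nest e x
  rwa [Γ.map_zero, Γ.map_zero, min_self, add_zero, inv_e] at this

theorem invRev {u : List (X × Bool)} {r : ℝ≥0} (h : MatchBound Γ u r) :
    MatchBound Γ (FreeGroup.invRev u) r := by
  induction h with
  | nil r => exact .nil r
  | append _ _ hu hv =>
    rw [FreeGroup.invRev_append, add_comm]
    exact hv.append hu
  | nest x y _ hu =>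
    have := hu.nest y x
    rw [nndist_comm, min_comm] at this
    rwa [FreeGroup.invRev_append, FreeGroup.invRev_append, word_inv, FreeGroup.invRev_invRev,
      ← word_inv, List.append_assoc]

/-- The first letter of a word is matched with some letter of the word, or with `e`. -/
theorem exists_of_cons {p : X × Bool} {a : Letter X} (ha : a⁻¹ = ofPair p)
    {v : List (X × Bool)} {r : ℝ≥0} (h : MatchBound Γ (p :: v) r) :
    ∃ (c : Letter X) (v₁ v₂ : List (X × Bool)) (s₁ s₂ : ℝ≥0), v = v₁ ++ (c.word ++ v₂) ∧
      MatchBound Γ v₁ s₁ ∧ MatchBound Γ v₂ s₂ ∧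
      nndist a c + min (Γ a s₁) (Γ c s₁) + s₂ ≤ r := by
  generalize hw : p :: v = w at h
  induction h generalizing v with
  | nil r => simp at hw
  | @append u t r s hu ht ihu iht =>
    cases u with
    | nil =>
      obtain ⟨c, v₁, v₂, s₁, s₂, h1, h2, h3, h4⟩ := iht hw
      exact ⟨c, v₁, v₂, s₁, s₂, h1, h2, h3, h4.trans le_add_self⟩
    | cons q u =>
      obtain ⟨rfl, rfl⟩ : p = q ∧ v = u ++ t := by simpa using hw
      obtain ⟨c, v₁, v₂, s₁, s₂, rfl, h2, h3, h4⟩ := ihu rfl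
      refine ⟨c, v₁, v₂ ++ t, s₁, s₂ + s, by simp, h2, h3.append ht, ?_⟩
      rw [← add_assoc]
      exact add_le_add_left h4 s
  | @nest u r x y hu ihu =>
    rcases eq_e_or_ofPair x⁻¹ with hx | ⟨q, hx⟩
    · obtain rfl : x = e := by rw [← inv_inv x, hx, inv_e]
      rw [Scale.min_map_e_left]
      cases u with
      | nil =>
        rcases eq_e_or_ofPair y with rfl | ⟨q, rfl⟩
        · simp [inv_e, word_e] at hw
        · obtain ⟨rfl, rfl⟩ : p = q ∧ v = [] := by simpa [inv_e, word_e, word_ofPair] using hw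
          refine ⟨e, [], [], 0, 0, by simp [word_e], .nil 0, .nil 0, ?_⟩
          rw [Γ.map_zero, Γ.map_zero, min_self, add_zero, add_zero, ← ha, nndist_e_inv,
            nndist_comm]
          exact le_self_add
      | cons q u =>
        obtain ⟨rfl, rfl⟩ : p = q ∧ v = u ++ y.word := by simpa [inv_e, word_e] using hw
        obtain ⟨c, v₁, v₂, s₁, s₂, rfl, h2, h3, h4⟩ := ihu rfl
        refine ⟨c, v₁, v₂ ++ y.word, s₁, s₂ + nndist e y, by simp, h2, h3.append (.single y), ?_⟩
        rw [← add_assoc, add_comm (nndist e y)]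
        exact add_le_add_left h4 _
    · rw [hx, word_ofPair] at hw
      obtain ⟨rfl, rfl⟩ : p = q ∧ v = u ++ y.word := by simpa using hw
      obtain rfl : a = x := inv_injective (ha.trans hx.symm)
      exact ⟨y, u, [], r, 0, by simp, hu, .nil 0, by rw [add_zero]⟩

/-- The last letter of a word is matched with some letter of the word, or with `e`. -/
theorem exists_of_concat {p : X × Bool} {a : Letter X} (ha : a = ofPair p)
    {v : List (X × Bool)} {r : ℝ≥0} (h : MatchBound Γ (v ++ [p]) r) :
    ∃ (c : Letter X) (v₁ v₂ : List (X × Bool)) (s₁ s₂ : ℝ≥0), v = v₁ ++ (c⁻¹.word ++ v₂) ∧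
      MatchBound Γ v₁ s₁ ∧ MatchBound Γ v₂ s₂ ∧
      s₁ + (nndist c a + min (Γ c s₂) (Γ a s₂)) ≤ r := by
  obtain ⟨x, b⟩ := p
  -- Inverting the word turns its last letter into a first one.
  have h' := h.invRev
  rw [FreeGroup.invRev_append] at h'
  obtain ⟨c, v₁, v₂, s₁, s₂, h1, h2, h3, h4⟩ :=
    exists_of_cons (a := a) (p := (x, !b)) (v := FreeGroup.invRev v)
      (by rw [ha, ofPair_inv]) h'
  refine ⟨c, FreeGroup.invRev v₂, FreeGroup.invRev v₁, s₂, s₁, ?_, h3.invRev, h2.invRev, ?_⟩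
  · rw [← FreeGroup.invRev_invRev (L₁ := v), h1, FreeGroup.invRev_append, FreeGroup.invRev_append,
      word_inv, List.append_assoc]
  · rwa [add_comm s₂, nndist_comm, min_comm]

/-- The new case is a pair straddling the junction. If `p` is matched with `b⁻¹` in `s` and `p'`
with `c` in `t`, then after erasure `b⁻¹` is matched with `c`, around what the two former matches
enclosed. The first adequacy inequality says that this is no more expensive. -/
theorem erase_append {p p' : X × Bool} (hp : (ofPair p)⁻¹ = ofPair p') (hΓ : Γ.IsAdequate)
    {s t : List (X × Bool)} {r₁ r₂ : ℝ≥0} (hs : MatchBound Γ s r₁) (ht : MatchBound Γ t r₂)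
    (ihs : ∀ u v, u ++ p :: p' :: v = s → MatchBound Γ (u ++ v) r₁)
    (iht : ∀ u v, u ++ p :: p' :: v = t → MatchBound Γ (u ++ v) r₂)
    {u v : List (X × Bool)} (h : u ++ p :: p' :: v = s ++ t) : MatchBound Γ (u ++ v) (r₁ + r₂) := by
  rcases List.append_eq_append_iff.1 h with ⟨w, rfl, h⟩ | ⟨w, rfl, rfl⟩
  · match w, h with
    | [], h =>
      simpa using hs.append (iht [] v (by simpa using h))
    | [q], h =>
      obtain ⟨rfl, rfl⟩ : p = q ∧ p' :: v = t := by simpa using h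
      obtain ⟨b, u₁, u₂, ρ₁, ρ₂, rfl, h2, h3, h4⟩ := exists_of_concat rfl hs
      obtain ⟨c, v₁, v₂, σ₁, σ₂, rfl, k2, k3, k4⟩ := exists_of_cons hp ht
      have H := h2.append (((h3.append k2).nest b c).append k3)
      refine MatchBound.mono (by simpa using H) ?_
      have A := (hΓ b c (ofPair p) ρ₂ σ₁).1
      rw [nndist_comm c, min_comm (Γ c σ₁)] at A
      calc _ ≤ ρ₁ + ((nndist b (ofPair p) + min (Γ b ρ₂) (Γ (ofPair p) ρ₂)) +
            (nndist (ofPair p) c + min (Γ (ofPair p) σ₁) (Γ c σ₁)) + σ₂) := by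
            rw [add_comm (nndist b c), ← add_assoc]
            refine (add_le_add_left (add_le_add_right A ρ₁) σ₂).trans_eq ?_
            ring
        _ = _ := by ring
        _ ≤ _ := add_le_add h4 k4
    | q :: q' :: w, h =>
      obtain ⟨rfl, rfl, rfl⟩ : p = q ∧ p' = q' ∧ v = w ++ t := by simpa using h
      simpa using (ihs u w rfl).append ht
  · simpa using hs.append (iht w v rfl)

/-- Induction on the match. The pair may straddle a junction, which is the previous lemma, or
involve an outer letter of a nest. In the latter case the inner letter of the pair had a partner
inside; this partner is rematched with the other outer letter, and the second adequacy inequality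
compares the costs. -/
theorem erase {p p' : X × Bool} (hp : (ofPair p)⁻¹ = ofPair p') (hΓ : Γ.IsAdequate)
    {u v : List (X × Bool)} {r : ℝ≥0} (h : MatchBound Γ (u ++ p :: p' :: v) r) :
    MatchBound Γ (u ++ v) r := by
  generalize hw : u ++ p :: p' :: v = w at h
  induction h generalizing u v with
  | nil r => simp at hw
  | append hs ht ihs iht => exact erase_append hp hΓ hs ht (fun _ _ => ihs) (fun _ _ => iht) hw
  | @nest s ρ x y hs ih =>
    -- The word of one letter is too short to contain a pair. This disposes of the single letter
    -- when an end of the nest is `e` and the nest is in fact a concatenation.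
    have short : ∀ (c : Letter X) (r : ℝ≥0) (u v : List (X × Bool)), u ++ p :: p' :: v = c.word →
        MatchBound Γ (u ++ v) r := fun c r u v h => by
      have := congrArg List.length h
      rcases eq_e_or_ofPair c with rfl | ⟨q, rfl⟩
      · simp [word_e] at this
      · simp [word_ofPair] at this
        omega
    rcases eq_e_or_ofPair x⁻¹ with hx | ⟨q, hx⟩
    · obtain rfl : x = e := by rw [← inv_inv x, hx, inv_e]
      rw [Scale.min_map_e_left, add_comm]
      exact erase_append hp hΓ hs (.single y) (fun _ _ => ih) (short _ _) hw
    rcases eq_e_or_ofPair y with rfl | ⟨q', rfl⟩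
    · rw [Scale.min_map_e_right, nndist_comm, ← nndist_e_inv]
      refine erase_append hp hΓ (.single x⁻¹) hs (short _ _) (fun _ _ => ih) ?_
      simpa [word_e] using hw
    rw [hx, word_ofPair, word_ofPair] at hw
    cases u with
    | nil =>
      obtain ⟨rfl, hw⟩ : p = q ∧ p' :: v = s ++ [q'] := by simpa using hw
      cases s with
      | nil =>
        obtain ⟨rfl, rfl⟩ : p' = q' ∧ v = [] := by simpa using hw
        exact .nil _
      | cons q s =>
        obtain ⟨rfl, rfl⟩ : p' = q ∧ v = s ++ [q'] := by simpa using hw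
        obtain ⟨c, v₁, v₂, s₁, s₂, rfl, h2, h3, h4⟩ := exists_of_cons hp hs
        -- The part `v₁` leaves the nest, and the former partner `c` of `p'` is matched with the
        -- closing letter around `v₂`.
        have H := h2.append (h3.nest c⁻¹ (ofPair q'))
        rw [word_ofPair, inv_inv] at H
        refine MatchBound.mono (by simpa using H) ?_
        have hx' : x = ofPair p' := by rw [← hp, ← hx, inv_inv]
        have A := (hΓ (ofPair q') c⁻¹ x s₂ s₁).2 _ rfl
        rw [inv_inv, hx, nndist_comm c⁻¹, nndist_comm _ x, nndist_comm _ c⁻¹] at A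
        have e1 : nndist x c⁻¹ = nndist (ofPair p) c := by
          rw [← nndist_inv_inv' x, hx, inv_inv]
        rw [e1] at A
        have le : s₂ + min (Γ c s₁) (Γ (ofPair p) s₁) + nndist (ofPair p) c ≤ ρ := by
          rw [min_comm (Γ c s₁)]
          refine le_trans (le_of_eq ?_) h4
          ring
        calc _ = min (Γ (ofPair q') s₂) (Γ c⁻¹ s₂) + nndist c⁻¹ (ofPair q') + s₁ := by
              rw [min_comm]; ring
          _ ≤ _ := A
          _ ≤ min (Γ (ofPair q') ρ) (Γ x ρ) + nndist x (ofPair q') :=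
              add_le_add_left (min_le_min (Γ.mono _ le) (Γ.mono _ le)) _
          _ = _ := by rw [min_comm, add_comm]
    | cons q₀ u =>
      obtain ⟨rfl, hw⟩ : q₀ = q ∧ u ++ p :: p' :: v = s ++ [q'] := by simpa using hw
      rcases List.eq_nil_or_concat v with rfl | ⟨v, q'', rfl⟩
      · have hw' : (u ++ [p]) ++ [p'] = s ++ [q'] := by simpa using hw
        obtain ⟨rfl, h⟩ := List.append_inj' hw' rfl
        obtain rfl : p' = q' := by simpa using h
        obtain ⟨c, u₁, u₂, s₁, s₂, rfl, h2, h3, h4⟩ := exists_of_concat rfl hs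
        -- Mirror case: the opening letter is matched with the former partner of `p`, and `u₂`
        -- leaves the nest.
        have H := (h2.nest x c⁻¹).append h3
        rw [hx, word_ofPair] at H
        refine MatchBound.mono (by simpa using H) ?_
        have A := (hΓ x c⁻¹ (ofPair p') s₁ s₂).2 _ rfl
        rw [inv_inv, ← hp, inv_inv, nndist_inv_inv'] at A
        have le : s₁ + min (Γ c s₂) (Γ (ofPair p) s₂) + nndist c (ofPair p) ≤ ρ := by
          refine le_trans (le_of_eq ?_) h4
          ring
        rw [← hp]
        calc _ = min (Γ x s₁) (Γ c⁻¹ s₁) + nndist x c⁻¹ + s₂ := by ring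
          _ ≤ _ := A
          _ ≤ min (Γ x ρ) (Γ (ofPair p)⁻¹ ρ) + nndist x (ofPair p)⁻¹ :=
              add_le_add_left (min_le_min (Γ.mono _ le) (Γ.mono _ le)) _
          _ = _ := add_comm _ _
      · have hw' : (u ++ p :: p' :: v) ++ [q''] = s ++ [q'] := by simpa using hw
        obtain ⟨h1, h2⟩ := List.append_inj' hw' rfl
        obtain rfl : q'' = q' := by simpa using h2
        have := (ih h1).nest x (ofPair q'')
        rw [hx, word_ofPair, word_ofPair] at this
        simpa using this

theorem of_red (hΓ : Γ.IsAdequate) {u v : List (X × Bool)} (huv : FreeGroup.Red u v) {r : ℝ≥0}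
    (h : MatchBound Γ u r) : MatchBound Γ v r := by
  induction huv with
  | refl => exact h
  | tail _ hstep ih =>
    cases hstep with
    | not => exact erase (ofPair_inv _ _) hΓ ih

end MatchBound

theorem PreNormValue.matchBound {u : List (Letter X)} {r : ℝ≥0} (h : PreNormValue Γ u r) :
    MatchBound Γ (u.flatMap word) r := by
  induction h with
  | nil => exact .nil 0
  | single x => simpa using MatchBound.single x
  | append _ _ hu hv => simpa using hu.append hv
  | nest x y _ hu => simpa using hu.nest x y

/-- For an adequate scale, the norm can be computed from the reduced word. -/
theorem matchBound_of_scaleNorm_lt (hΓ : Γ.IsAdequate) {w : List (X × Bool)}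
    (hw : FreeGroup.IsReduced w) {t : ℝ≥0} (h : scaleNorm Γ (FreeGroup.mk w) < t) :
    MatchBound Γ w t := by
  classical
  obtain ⟨u, r, hu, hr, hlt⟩ := exists_lt_of_scaleNorm_lt h
  rw [prod_toFree_eq_mk] at hu
  have h1 := hr.matchBound.of_red hΓ FreeGroup.reduce.red
  rw [FreeGroup.reduce.sound hu, hw.reduce_eq] at h1
  exact h1.mono hlt.le

/-- A function on the letters that is constant on small balls sums up to zero on the words of
small bound. -/
theorem MatchBound.sum_eq_zero {φ : Letter X → ℤ} {η : ℝ≥0} (he : φ e = 0)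
    (hinv : ∀ a, φ a⁻¹ = -φ a) (hφ : ∀ a b, nndist a b < η → φ a = φ b)
    {w : List (X × Bool)} {r : ℝ≥0} (h : MatchBound Γ w r) (hr : r < η) :
    (w.map fun p => φ (ofPair p)).sum = 0 := by
  have hword : ∀ a : Letter X, (a.word.map fun p => φ (ofPair p)).sum = φ a := fun a => by
    rcases eq_e_or_ofPair a with rfl | ⟨p, rfl⟩
    · simp [word_e, he]
    · simp [word_ofPair]
  induction h with
  | nil r => rfl
  | append _ _ hu hv =>
    rw [List.map_append, List.sum_append, hu (lt_of_le_of_lt le_self_add hr),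
      hv (lt_of_le_of_lt le_add_self hr), add_zero]
  -- Both the distance of the matched letters and the inner bound are below `η`, so the
  -- contributions `-φ x` and `φ y` cancel.
  | @nest u r x y _ hu =>
    rw [List.map_append, List.map_append, List.sum_append, List.sum_append, hword, hword, hinv,
      hu (lt_of_le_of_lt ((Scale.le_min_map Γ x y r).trans le_add_self) hr),
      hφ x y (lt_of_le_of_lt le_self_add hr)]
    ring

end MatchBound

/-! ### A criterion for failing to be CLI -/

section CLI

/-- In a CLI group, every Cauchy sequence of the left uniformity converges. -/
theorem IsCLI.exists_tendsto {G : Type*} [Group G] [t : TopologicalSpace G]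
    [IsTopologicalGroup G] [PolishSpace G] (h : IsCLI G) {a : ℕ → G}
    (ha : Tendsto (fun p : ℕ × ℕ => (a p.1)⁻¹ * a p.2) atTop (𝓝 1)) :
    ∃ L, Tendsto a atTop (𝓝 L) := by
  obtain ⟨m, rfl, hc, hinv⟩ := h
  refine cauchySeq_tendsto_of_complete (Metric.cauchySeq_iff.2 fun ε hε => ?_)
  obtain ⟨⟨M, N⟩, H⟩ := eventually_atTop.1 (Metric.tendsto_nhds.1 ha ε hε)
  refine ⟨max M N, fun k hk l hl => ?_⟩
  have := H (k, l) ⟨(le_max_left M N).trans hk, (le_max_right M N).trans hl⟩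
  -- Left invariance turns closeness of `(a k)⁻¹ * a l` to `1` into closeness of `a k` and `a l`.
  have e : dist (a k) (a l) = dist (a k * 1) (a k * ((a k)⁻¹ * a l)) := by
    rw [mul_one, mul_inv_cancel_left]
  rw [e, dist_comm]
  exact (hinv _ _ _).trans_lt this

/-- Summability makes the sequence left Cauchy, so in a CLI group it has a limit `L`. Then `g (n +
1) * (g n)⁻¹` tends to `L * L⁻¹ = 1`, against the lower bound on its norm. -/
theorem not_isCLI_of_scaleNorm {X : Type*} [LetterMetric X] [Countable X] (Γ : Scale X)
    (g : ℕ → ScaledFreeGroup Γ) {d : ℕ → ℝ} (hd : Summable d)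
    (hg : ∀ n, (scaleNorm Γ ((g n)⁻¹ * g (n + 1)) : ℝ) ≤ d n) {c : ℝ≥0} (hc : 0 < c)
    (hgc : ∀ n, c ≤ scaleNorm Γ (g (n + 1) * (g n)⁻¹)) : ¬ IsCLI (ScaledCompletion Γ) := by
  intro h
  have hcauchy : ∀ ε > 0, ∃ N, ∀ k ≥ N, ∀ l ≥ N, scaleDelta Γ (g k) (g l) < ε := by
    -- The sequence is Cauchy for the left distance `δ_Γ` only, not for `Δ_Γ`; hence this auxiliary
    -- pseudometric.
    let _ : PseudoMetricSpace (FreeGroup X) :=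
      { dist := scaleDelta Γ
        dist_self := scaleDelta_self Γ
        dist_comm := scaleDelta_comm Γ
        dist_triangle := scaleDelta_triangle Γ }
    exact Metric.cauchySeq_iff.1
      (cauchySeq_of_dist_le_of_summable (α := FreeGroup X) (f := g) d hg hd)
  have dist_one : ∀ k : ScaledFreeGroup Γ, dist (ScaledCompletion.of Γ k) 1 = scaleNorm Γ k := by
    intro k
    rw [← ScaledCompletion.of_one, (ScaledCompletion.isometry_of Γ).dist_eq,
      dist_scaled, mul_one, inv_one, mul_one]
    exact (congrArg (fun r : ℝ≥0 => max (r : ℝ) (scaleNorm Γ k)) (scaleNorm_inv Γ k)).trans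
      (max_self _)
  obtain ⟨L, hL⟩ := h.exists_tendsto (a := fun n => ScaledCompletion.of Γ (g n)) (by
    refine Metric.tendsto_nhds.2 fun ε hε => ?_
    obtain ⟨N, hN⟩ := hcauchy ε hε
    refine eventually_atTop.2 ⟨(N, N), fun p hp => ?_⟩
    rw [← ScaledCompletion.of_inv, ← ScaledCompletion.of_mul]
    exact (dist_one _).trans_lt (hN p.1 hp.1 p.2 hp.2))
  have h1 := ((tendsto_add_atTop_iff_nat 1).2 hL).mul hL.inv
  rw [mul_inv_cancel] at h1
  obtain ⟨n, hn⟩ := (Metric.tendsto_nhds.1 h1 c (by exact_mod_cast hc)).exists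
  rw [← ScaledCompletion.of_inv, ← ScaledCompletion.of_mul] at hn
  have := (dist_one (g (n + 1) * (g n)⁻¹)).symm.trans_lt hn
  exact (hgc n).not_gt (by exact_mod_cast this)

end CLI

/-! ### Expansion near zero from subadditivity -/

section Expansion

variable {X : Type*} [LetterMetric X] {Γ : Scale X}

theorem Scale.IsAdequate.map_add_le (hΓ : Γ.IsAdequate) (x : Letter X) (r s : ℝ≥0) :
    Γ x (r + s) ≤ Γ x r + Γ x s := by
  simpa using (hΓ x x x r s).1

theorem Scale.IsAdequate.map_nsmul_le (hΓ : Γ.IsAdequate) (x : Letter X) (r : ℝ≥0) (n : ℕ) :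
    Γ x (n * r) ≤ n * Γ x r := by
  induction n with
  | zero => simp [Γ.map_zero]
  | succ n ih =>
    push_cast
    rw [add_mul, add_mul, one_mul, one_mul]
    exact (hΓ.map_add_le x _ _).trans (add_le_add_left ih _)

/-- A non-trivial adequate scale is expanding near zero at some letter. -/
theorem Scale.IsAdequate.exists_expanding (hΓ : Γ.IsAdequate) (hnt : ¬ Γ.IsTrivial) :
    ∃ (p : X × Bool) (c r₀ : ℝ≥0), 1 < c ∧ 0 < r₀ ∧ ∀ r ≤ r₀, c * r ≤ Γ (ofPair p) r := by
  simp only [Scale.IsTrivial, not_forall] at hnt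
  obtain ⟨a, R, hne⟩ := hnt
  have hlt : R < Γ a R := lt_of_le_of_ne (Γ.le_map a R) (Ne.symm hne)
  rcases eq_e_or_ofPair a with rfl | ⟨p, rfl⟩
  · exact absurd (Γ.map_e R) hne
  have hR : 0 < R := pos_iff_ne_zero.2 fun h => hne (by rw [h, Γ.map_zero])
  -- The room between `R` and `S` absorbs the rounding of `R / r` to an integer `n`: for `r ≤ S -
  -- R`, one has `R ≤ n * r ≤ S`. Subadditivity then gives `Γ R ≤ n * Γ r`, whence the factor `Γ R /
  -- S > 1`.
  obtain ⟨S, hS1, hS2⟩ := exists_between hlt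
  have hS : 0 < S := hR.trans hS1
  refine ⟨p, Γ (ofPair p) R / S, S - R, (one_lt_div hS).2 hS2, tsub_pos_of_lt hS1, fun r hr => ?_⟩
  rcases eq_or_ne r 0 with rfl | hr0
  · simp
  have hr0 : 0 < r := pos_iff_ne_zero.2 hr0
  set n := ⌈R / r⌉₊
  have h1 : R ≤ n * r := (div_le_iff₀ hr0).1 (Nat.le_ceil _)
  have h2 : n * r ≤ S := by
    have : (n : ℝ≥0) * r ≤ (R / r + 1) * r :=
      mul_le_mul_left (Nat.ceil_lt_add_one zero_le).le r
    rw [add_mul, div_mul_cancel₀ _ hr0.ne', one_mul] at this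
    exact this.trans ((add_le_add_right hr R).trans_eq (add_tsub_cancel_of_le hS1.le))
  have h3 := (Γ.mono _ h1).trans (hΓ.map_nsmul_le (ofPair p) r n)
  rw [div_mul_eq_mul_div, div_le_iff₀ hS]
  calc _ ≤ n * Γ (ofPair p) r * r := mul_le_mul_left h3 r
    _ = n * r * Γ (ofPair p) r := by ring
    _ ≤ S * Γ (ofPair p) r := mul_le_mul_left h2 _
    _ = _ := mul_comm _ _

end Expansion

/-! ### Lower bound for the nested conjugates -/

/-- A sequence of letters `(z i, s)`, each of which is separated at distance `d i` from the next
ones and from the letter `(x, s)` by an integer-valued function. -/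
structure SeparatedLetters (X : Type*) [LetterMetric X] where
  x : X
  s : Bool
  z : ℕ → X
  d : ℕ → ℝ≥0
  φ : ℕ → Letter X → ℤ
  map_e : ∀ i, φ i e = 0
  map_inv : ∀ i a, φ i a⁻¹ = -φ i a
  map_eq : ∀ i a b, nndist a b < d i → φ i a = φ i b
  map_x : ∀ i, φ i (ofPair (x, s)) = 0
  map_z : ∀ i j, i < j → φ i (ofPair (z j, s)) = 0
  map_self : ∀ i, φ i (ofPair (z i, s)) ≠ 0
  le_nndist_e : ∀ i, d i ≤ nndist (ofPair (x, s)) e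

namespace SeparatedLetters

variable {X : Type*} [LetterMetric X] (S : SeparatedLetters X)

theorem ofPair_not (v : X) : ofPair (v, !S.s) = (ofPair (v, S.s))⁻¹ := (ofPair_inv v S.s).symm

theorem x_ne (i : ℕ) : S.x ≠ S.z i := fun h => S.map_self i (by rw [← h, S.map_x])

theorem z_ne {i j : ℕ} (h : i < j) : S.z j ≠ S.z i := fun e =>
  S.map_self i (by rw [← e, S.map_z i j h])

/-- The word of the conjugate of `x⁻¹ z (i + k)` by `x⁻¹ z i ⋯ x⁻¹ z (i + k - 1)`. -/
def word : ℕ → ℕ → List (X × Bool)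
  | i, 0 => [(S.x, !S.s), (S.z i, S.s)]
  | i, k + 1 => (S.x, !S.s) :: (S.z i, S.s) :: (word (i + 1) k ++ [(S.z i, !S.s), (S.x, S.s)])

theorem map_of_mem_word {i j k : ℕ} (hij : i < j) {p : X × Bool} (hp : p ∈ S.word j k) :
    S.φ i (ofPair p) = 0 := by
  induction k generalizing j with
  | zero =>
    rw [word] at hp
    simp only [List.mem_cons, List.not_mem_nil, or_false] at hp
    rcases hp with rfl | rfl
    · rw [ofPair_not, S.map_inv, S.map_x, neg_zero]
    · exact S.map_z i j hij
  | succ k ih =>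
    rw [word] at hp
    simp only [List.mem_cons, List.mem_append, List.not_mem_nil, or_false] at hp
    rcases hp with rfl | rfl | hp | rfl | rfl
    · rw [ofPair_not, S.map_inv, S.map_x, neg_zero]
    · exact S.map_z i j hij
    · exact ih (hij.trans (Nat.lt_succ_self j)) hp
    · rw [ofPair_not, S.map_inv, S.map_z i j hij, neg_zero]
    · exact S.map_x i

/-- Matches control the norm only through reduced words. The clauses on the last and first letters
are what the induction needs to exclude cancellation at both ends of the inner word. -/
theorem isReduced_word (i k : ℕ) : FreeGroup.IsReduced (S.word i k) ∧
    (∀ p ∈ (S.word i k).getLast?, ∀ j < i, p.1 ≠ S.z j) ∧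
    ∀ p ∈ (S.word i k).head?, p.1 = S.x := by
  induction k generalizing i with
  | zero =>
    rw [word]
    refine ⟨?_, ?_, by simp⟩
    · simp [S.x_ne i]
    · simpa using fun j hj => S.z_ne hj
  | succ k ih =>
    obtain ⟨h1, h2, h3⟩ := ih (i + 1)
    rw [word]
    refine ⟨?_, ?_, by simp⟩
    · refine List.isChain_cons_cons.2 ⟨fun h => absurd h (S.x_ne i), ?_⟩
      have h4 : FreeGroup.IsReduced (S.word (i + 1) k ++ [(S.z i, !S.s), (S.x, S.s)]) := by
        refine List.isChain_append.2 ⟨h1, ?_, ?_⟩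
        · simp [(S.x_ne i).symm]
        · rintro p hp q hq h
          obtain rfl : (S.z i, !S.s) = q := by simpa using hq
          exact absurd h (h2 p hp i (Nat.lt_succ_self i))
      have h5 : S.word (i + 1) k ≠ [] := by cases k <;> simp [word]
      obtain ⟨p, w, hw⟩ := List.exists_cons_of_ne_nil h5
      rw [hw] at h3 h4 ⊢
      refine List.isChain_cons_cons.2 ⟨fun h => ?_, h4⟩
      exact absurd (h3 p rfl) (fun h' => S.x_ne i (h'.symm.trans h.symm))
    · intro p hp j _
      obtain rfl : (S.x, S.s) = p := by
        rw [← List.cons_append, ← List.cons_append, List.getLast?_append] at hp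
        simpa using hp
      exact S.x_ne j

variable {Γ : Scale X}

theorem sum_eq_zero {i : ℕ} {w : List (X × Bool)} {r : ℝ≥0} (h : MatchBound Γ w r)
    (hr : r < S.d i) : (w.map fun p => S.φ i (ofPair p)).sum = 0 :=
  h.sum_eq_zero (S.map_e i) (S.map_inv i) (S.map_eq i) hr

/-- Below cost `d i`, the partner of `z i` must have a nonzero value of `φ i`. Only the final `z
i⁻¹` qualifies, so the match encloses exactly `w`. -/
theorem matchBound_nest {i : ℕ} {w : List (X × Bool)} (hw : ∀ p ∈ w, S.φ i (ofPair p) = 0)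
    {b r : ℝ≥0} (hb : ∀ r, MatchBound Γ w r → b ≤ r)
    (h : MatchBound Γ ((S.z i, S.s) :: (w ++ [(S.z i, !S.s)])) r) (hr : r < S.d i) : b ≤ r := by
  have ha : (ofPair (S.z i, !S.s))⁻¹ = ofPair (S.z i, S.s) := by rw [ofPair_not, inv_inv]
  obtain ⟨c, v₁, v₂, s₁, s₂, h1, h2, h3, h4⟩ := h.exists_of_cons ha
  have hc : S.φ i c ≠ 0 := by
    rw [← S.map_eq i _ c (lt_of_le_of_lt ((le_self_add.trans le_self_add).trans h4) hr),
      ofPair_not, S.map_inv, neg_ne_zero]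
    exact S.map_self i
  rcases eq_e_or_ofPair c with rfl | ⟨q, rfl⟩
  · exact absurd (S.map_e i) hc
  rw [word_ofPair] at h1
  have hv : v₁ = w := by
    rcases List.append_eq_append_iff.1 h1 with ⟨t, rfl, ht⟩ | ⟨t, rfl, ht⟩
    · cases t with
      | nil => simp
      | cons a t => simp at ht
    · cases t with
      | nil => simp
      | cons a t =>
        obtain ⟨rfl, -⟩ : q = a ∧ v₂ = t ++ [(S.z i, !S.s)] := by simpa using ht
        exact absurd (hw q (by simp)) hc
  subst hv
  exact (hb _ h2).trans (((Scale.le_min_map Γ _ _ _).trans le_add_self).trans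
    (le_self_add.trans h4))

/-- A match cheaper than `b i ≤ d i` has no choice at level `i`: `φ i` forces the outer `x⁻¹` to be
matched with the outer `x`. Since both ends are the same letter, the minimum is `Γ x` itself, and
the bound `b (i + 1)` of the inner word is raised to at least `b i`. -/
theorem le_of_matchBound_word {b : ℕ → ℝ≥0} (hbd : ∀ i, b i ≤ S.d i)
    (hb : ∀ i, b i ≤ Γ (ofPair (S.x, S.s)) (b (i + 1))) (i k : ℕ) {r : ℝ≥0}
    (h : MatchBound Γ (S.word i k) r) : b i ≤ r := by
  induction k generalizing i r with
  | zero =>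
    by_contra! hr
    have := S.sum_eq_zero h (hr.trans_le (hbd i))
    rw [word] at this
    simp only [List.map_cons, List.map_nil, List.sum_cons, List.sum_nil, ofPair_not, S.map_inv,
      S.map_x] at this
    exact S.map_self i (by simpa using this)
  | succ k ih =>
    by_contra! hr
    have hrd := hr.trans_le (hbd i)
    rw [word] at h
    have hw : ∀ p ∈ S.word (i + 1) k, S.φ i (ofPair p) = 0 :=
      fun p hp => S.map_of_mem_word (Nat.lt_succ_self i) hp
    obtain ⟨c, v₁, v₂, s₁, s₂, h1, h2, h3, h4⟩ := h.exists_of_cons (S.ofPair_not S.x).symm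
    have h5 : nndist (ofPair (S.x, S.s)) c < S.d i :=
      lt_of_le_of_lt ((le_self_add.trans le_self_add).trans h4) hrd
    have h6 : s₁ < S.d i := lt_of_le_of_lt (((Scale.le_min_map Γ _ _ _).trans le_add_self).trans
      (le_self_add.trans h4)) hrd
    have hs := S.sum_eq_zero h2 h6
    obtain ⟨q, rfl⟩ : ∃ q, c = ofPair q := by
      rcases eq_e_or_ofPair c with rfl | hc
      · exact absurd h5 (S.le_nndist_e i).not_gt
      · exact hc
    have hq : S.φ i (ofPair q) = 0 := by rw [← S.map_eq i _ _ h5, S.map_x]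
    rw [word_ofPair] at h1
    cases v₁ with
    | nil =>
      obtain ⟨rfl, -⟩ := List.cons.inj h1
      exact S.map_self i hq
    | cons a v =>
      obtain ⟨rfl, hk⟩ : (S.z i, S.s) = a ∧
          S.word (i + 1) k ++ [(S.z i, !S.s), (S.x, S.s)] = v ++ ([q] ++ v₂) :=
        List.cons.inj h1
      -- If the partner of `x⁻¹` came no later than `z i⁻¹`, the enclosed part would be `z i`
      -- followed by letters killed by `φ i`; its sum would be nonzero, contradicting `hs`.
      have hv : ∀ u, (S.word (i + 1) k) ≠ v ++ u := by
        intro u hu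
        rw [List.map_cons, List.sum_cons, List.sum_eq_zero, add_zero] at hs
        · exact S.map_self i hs
        · intro n hn
          obtain ⟨p, hp, rfl⟩ := List.mem_map.1 hn
          exact hw p (by rw [hu]; exact List.mem_append_left u hp)
      rcases List.append_eq_append_iff.1 hk with ⟨t, rfl, h⟩ | ⟨t, h, -⟩
      · match t, h with
        | [], _ => exact hv [] (by simp)
        -- The only remaining position: the partner is the final `x`, and the enclosed part is `z
        -- i`, the inner word, `z i⁻¹`.
        | [a], h =>
          obtain ⟨rfl, rfl, -⟩ : (S.z i, !S.s) = a ∧ (S.x, S.s) = q ∧ [] = v₂ := by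
            simpa using h
          have := S.matchBound_nest hw (fun r => ih (i + 1)) h2 h6
          refine hr.not_ge ((hb i).trans ((Γ.mono _ this).trans ?_))
          rw [min_self] at h4
          exact le_add_self.trans (le_self_add.trans h4)
        | a :: a' :: t, h => simp at h
      · exact hv t h

/-- The products of the elements `x⁻¹ z i`. -/
def partialProd : ℕ → FreeGroup X
  | 0 => 1
  | n + 1 => partialProd n * FreeGroup.mk [(S.x, !S.s), (S.z n, S.s)]

/-- Each conjugation by `x⁻¹ z i` adds one outer layer. With `k = 0` this writes `g (n + 1) * (g
n)⁻¹` as a nested word of depth `n`. -/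
theorem conj_mk_word (n k : ℕ) :
    S.partialProd n * FreeGroup.mk (S.word n k) * (S.partialProd n)⁻¹ =
      FreeGroup.mk (S.word 0 (n + k)) := by
  induction n generalizing k with
  | zero => simp [partialProd]
  | succ n ih =>
    have h : FreeGroup.mk (S.word n (k + 1)) = FreeGroup.mk [(S.x, !S.s), (S.z n, S.s)] *
        FreeGroup.mk (S.word (n + 1) k) * (FreeGroup.mk [(S.x, !S.s), (S.z n, S.s)])⁻¹ := by
      rw [FreeGroup.inv_mk, FreeGroup.mul_mk, FreeGroup.mul_mk, word]
      simp [FreeGroup.invRev]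
    rw [show n + 1 + k = n + (k + 1) by omega, ← ih, h, partialProd]
    group

theorem le_scaleNorm (hΓ : Γ.IsAdequate) {b : ℕ → ℝ≥0} (hbd : ∀ i, b i ≤ S.d i)
    (hb : ∀ i, b i ≤ Γ (ofPair (S.x, S.s)) (b (i + 1))) (n : ℕ) :
    b 0 ≤ scaleNorm Γ (S.partialProd (n + 1) * (S.partialProd n)⁻¹) := by
  have h : S.partialProd (n + 1) * (S.partialProd n)⁻¹ = FreeGroup.mk (S.word 0 n) :=
    S.conj_mk_word n 0
  rw [h]
  refine le_of_forall_gt fun t ht => ?_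
  obtain ⟨u, hu1, hu2⟩ := exists_between ht
  exact (S.le_of_matchBound_word hbd hb 0 n
    (matchBound_of_scaleNorm_lt hΓ (S.isReduced_word 0 n).1 hu1)).trans_lt hu2

theorem scaleNorm_le (n : ℕ) : scaleNorm Γ ((S.partialProd n)⁻¹ * S.partialProd (n + 1)) ≤
    nndist (ofPair (S.x, S.s)) (ofPair (S.z n, S.s)) := by
  have h := _root_.scaleNorm_le
    ((PreNormValue.nil (Γ := Γ)).nest (ofPair (S.x, S.s)) (ofPair (S.z n, S.s)))
  rw [Γ.map_zero, Γ.map_zero, min_self, add_zero] at h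
  rw [partialProd, inv_mul_cancel_left]
  refine le_of_eq_of_le ?_ h
  rw [← ofPair_not, List.nil_append, List.map_cons, List.map_cons, List.map_nil, List.prod_cons,
    List.prod_cons, List.prod_nil, mul_one, toFree_ofPair, toFree_ofPair, FreeGroup.mul_mk]
  rfl

end SeparatedLetters

/-! ### Separated letters in the space of eventually zero sequences -/

namespace EventuallyZeroSeq

theorem seqDist_ultra (x y z : EventuallyZeroSeq) :
    seqDist x z ≤ max (seqDist x y) (seqDist y z) := by
  rw [seqDist_eq, seqDist_eq, seqDist_eq]
  exact PiNat.dist_triangle_nonarch _ _ _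

theorem seqDist_lt_iff {x y : EventuallyZeroSeq} {η : ℝ} (h : seqDist x y < η)
    (z : EventuallyZeroSeq) : seqDist x z < η ↔ seqDist y z < η := by
  refine ⟨fun h' => ?_, fun h' => ?_⟩
  · exact (seqDist_ultra y x z).trans_lt (max_lt (by rwa [seqDist_comm]) h')
  · exact (seqDist_ultra x y z).trans_lt (max_lt h h')

/-- The sequence obtained by adding `k + 1` to the term of index `m`. -/
def shift (x : EventuallyZeroSeq) (m k : ℕ) : EventuallyZeroSeq :=
  ⟨fun i => if i = m then x.1 i + (k + 1) else x.1 i, by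
    obtain ⟨n, hn⟩ := x.2
    refine ⟨max n (m + 1), fun i hi => ?_⟩
    exact (if_neg (by omega)).trans (hn i (by omega))⟩

theorem shift_apply_self (x : EventuallyZeroSeq) (m k : ℕ) :
    (x.shift m k).1 m = x.1 m + (k + 1) := if_pos rfl

theorem shift_apply_of_ne (x : EventuallyZeroSeq) {m i : ℕ} (k : ℕ) (h : i ≠ m) :
    (x.shift m k).1 i = x.1 i := if_neg h

theorem le_seqDist {x y : EventuallyZeroSeq} {n : ℕ} (h : x.1 n ≠ y.1 n) :
    (1 / 2 : ℝ) ^ n ≤ seqDist x y := by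
  rw [seqDist, if_neg fun e => h (by rw [e])]
  refine pow_le_pow_of_le_one (by norm_num) (by norm_num) ?_
  by_contra! hlt
  exact h (PiNat.apply_eq_of_lt_firstDiff hlt)

theorem seqDist_shift_le (x : EventuallyZeroSeq) (m k : ℕ) :
    seqDist x (x.shift m k) ≤ (1 / 2 : ℝ) ^ m := by
  unfold seqDist
  split_ifs with h
  · positivity
  · refine pow_le_pow_of_le_one (by norm_num) (by norm_num) ?_
    by_contra! hlt
    have hne : x.1 ≠ (x.shift m k).1 := fun e => h (Subtype.ext e)
    exact PiNat.apply_firstDiff_ne hne (shift_apply_of_ne x k hlt.ne).symm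

theorem le_seqDist_shift (x : EventuallyZeroSeq) (m k : ℕ) :
    (1 / 2 : ℝ) ^ m ≤ seqDist x (x.shift m k) :=
  le_seqDist (by rw [shift_apply_self]; omega)

/-- Distinct increments keep the points separated even when the indices `m` and `m'` coincide, which
happens when two radii are rounded to the same power of `1 / 2`. -/
theorem le_seqDist_shift_shift (x : EventuallyZeroSeq) (m m' : ℕ) {k k' : ℕ} (h : k ≠ k') :
    (1 / 2 : ℝ) ^ m ≤ seqDist (x.shift m k) (x.shift m' k') := by
  refine le_seqDist ?_
  rw [shift_apply_self]
  by_cases hm : m = m'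
  · subst hm
    rw [shift_apply_self]
    omega
  · rw [shift_apply_of_ne x k' hm]
    omega

/-- The signed indicator function of a ball of the alphabet. -/
noncomputable def ballIndicator (z : EventuallyZeroSeq) (η : ℝ) : Letter EventuallyZeroSeq → ℤ
  | e => 0
  | pos v => {v | seqDist v z < η}.indicator 1 v
  | neg v => -{v | seqDist v z < η}.indicator 1 v

theorem nndist_eq (a b : Letter EventuallyZeroSeq) : (nndist a b : ℝ) = letterDist a b := rfl

theorem nndist_ofPair (u v : EventuallyZeroSeq) (s : Bool) :
    (nndist (ofPair (u, s)) (ofPair (v, s)) : ℝ) = seqDist u v := by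
  cases s <;> rfl

theorem ballIndicator_inv (z : EventuallyZeroSeq) (η : ℝ) (a : Letter EventuallyZeroSeq) :
    ballIndicator z η a⁻¹ = -ballIndicator z η a := by
  cases a
  · rfl
  · rfl
  · exact (neg_neg _).symm

theorem indicator_ball_eq {u v : EventuallyZeroSeq} {η : ℝ} (h : seqDist u v < η)
    (z : EventuallyZeroSeq) : {v | seqDist v z < η}.indicator (1 : EventuallyZeroSeq → ℤ) u =
      {v | seqDist v z < η}.indicator 1 v := by
  have hiff : u ∈ {v | seqDist v z < η} ↔ v ∈ {v | seqDist v z < η} := seqDist_lt_iff h z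
  by_cases hu : u ∈ {v | seqDist v z < η}
  · rw [Set.indicator_of_mem hu, Set.indicator_of_mem (hiff.1 hu)]
    rfl
  · rw [Set.indicator_of_notMem hu, Set.indicator_of_notMem (mt hiff.2 hu)]

/-- The distance is an ultrametric, so points closer than `η` lie in the same balls of radius `η`.
As `η ≤ 1`, letters of different kinds, at distance `1`, are never that close. -/
theorem ballIndicator_eq (z : EventuallyZeroSeq) {η : ℝ} (hη : η ≤ 1)
    {a b : Letter EventuallyZeroSeq} (h : letterDist a b < η) :
    ballIndicator z η a = ballIndicator z η b := by
  cases a <;> cases b <;> first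
    | rfl
    | exact indicator_ball_eq h z
    | exact congrArg Neg.neg (indicator_ball_eq h z)
    | exact absurd h hη.not_gt

theorem ballIndicator_ofPair_self (z : EventuallyZeroSeq) {η : ℝ} (hη : 0 < η) (s : Bool) :
    ballIndicator z η (ofPair (z, s)) ≠ 0 := by
  have h : z ∈ {v | seqDist v z < η} := by simpa [seqDist_self] using hη
  cases s <;> simp [ballIndicator, ofPair, Set.indicator_of_mem h]

theorem ballIndicator_ofPair_of_le {z v : EventuallyZeroSeq} {η : ℝ} (h : η ≤ seqDist v z)
    (s : Bool) : ballIndicator z η (ofPair (v, s)) = 0 := by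
  have h : v ∉ {v | seqDist v z < η} := h.not_gt
  cases s <;> simp [ballIndicator, ofPair, Set.indicator_of_notMem h]

/-- Letters at distance `2 ^ (- m i)` from a given one, separated from the next ones. -/
noncomputable def shiftedLetters (p : EventuallyZeroSeq × Bool) (m : ℕ → ℕ) :
    SeparatedLetters EventuallyZeroSeq where
  x := p.1
  s := p.2
  z i := p.1.shift (m i) i
  d i := (1 / 2) ^ m i
  φ i := ballIndicator (p.1.shift (m i) i) ((1 / 2) ^ m i)
  map_e _ := rfl
  map_inv _ := ballIndicator_inv _ _
  map_eq i a b h := by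
    refine ballIndicator_eq _ (pow_le_one₀ (by norm_num) (by norm_num)) ?_
    rw [← nndist_eq]
    have : (nndist a b : ℝ) < ((1 / 2 : ℝ≥0) ^ m i : ℝ≥0) := NNReal.coe_lt_coe.2 h
    simpa using this
  map_x i := ballIndicator_ofPair_of_le (le_seqDist_shift _ _ _) _
  map_z i j hij := ballIndicator_ofPair_of_le
    (by rw [seqDist_comm]; exact le_seqDist_shift_shift _ _ _ hij.ne) _
  map_self i := ballIndicator_ofPair_self _ (by positivity) _
  le_nndist_e i := by
    refine NNReal.coe_le_coe.1 ?_
    have h : (nndist (ofPair (p.1, p.2)) e : ℝ) = 1 := by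
      obtain ⟨x, _ | _⟩ := p <;> rfl
    rw [h]
    exact_mod_cast pow_le_one₀ zero_le (by
      rw [one_div]; exact inv_le_one_of_one_le₀ one_le_two : (1 / 2 : ℝ≥0) ≤ 1)

end EventuallyZeroSeq

/-! ### The theorem -/

open EventuallyZeroSeq in
theorem mainTheorem7 (Γ : Scale EventuallyZeroSeq) (hΓ : Γ.IsAdequate) (hnt : ¬ Γ.IsTrivial) :
    ¬ IsCLI (ScaledCompletion Γ) := by
  obtain ⟨p, c, r₀, hc, hr₀, H⟩ := hΓ.exists_expanding hnt
  have hc0 : 0 < c := one_pos.trans hc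
  have hcinv : c⁻¹ < 1 := inv_lt_one_of_one_lt₀ hc
  -- `κ ≤ r₀` keeps all radii `κ * c⁻¹ ^ i` in the range of expansion; `κ ≤ 1` lets them be rounded
  -- up to powers of `1 / 2`, at most doubling them.
  obtain ⟨κ, hκ, hκr, hκ1⟩ : ∃ κ : ℝ≥0, 0 < κ ∧ κ ≤ r₀ ∧ κ ≤ 1 :=
    ⟨min r₀ 1, lt_min hr₀ one_pos, min_le_left _ _, min_le_right _ _⟩
  have hpow : ∀ i, κ * c⁻¹ ^ i ≤ κ := fun i =>
    mul_le_of_le_one_right zero_le (pow_le_one₀ zero_le hcinv.le)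
  have hm : ∀ i, ∃ m : ℕ, κ * c⁻¹ ^ i ≤ (1 / 2 : ℝ≥0) ^ m ∧
      (1 / 2 : ℝ) ^ m ≤ 2 * (κ * c⁻¹ ^ i : ℝ≥0) := by
    intro i
    have h0 : 0 < κ * c⁻¹ ^ i := by positivity
    obtain ⟨m, h1, h2⟩ := exists_nat_pow_near_of_lt_one (x := ((κ * c⁻¹ ^ i : ℝ≥0) : ℝ))
      (y := 1 / 2) (by exact_mod_cast h0) (by exact_mod_cast (hpow i).trans hκ1) (by norm_num)
      (by norm_num)
    refine ⟨m, NNReal.coe_le_coe.1 (by simpa using h2), ?_⟩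
    rw [pow_succ] at h1
    linarith
  choose m hm1 hm2 using hm
  set S := shiftedLetters p m
  have hsum : Summable fun i => 2 * ((κ * c⁻¹ ^ i : ℝ≥0) : ℝ) := by
    push_cast
    refine ((summable_geometric_of_lt_one (by positivity) ?_).mul_left (κ : ℝ)).mul_left 2
    exact_mod_cast hcinv
  refine not_isCLI_of_scaleNorm Γ S.partialProd hsum (fun n => ?_) (c := κ * c⁻¹ ^ 0)
    (by positivity) (S.le_scaleNorm hΓ (b := fun i => κ * c⁻¹ ^ i) hm1 fun i => ?_)
  · refine le_trans (NNReal.coe_le_coe.2 (S.scaleNorm_le n)) (le_trans ?_ (hm2 n))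
    rw [nndist_ofPair]
    exact seqDist_shift_le _ _ _
  -- `κ * c⁻¹ ^ i` is exactly `c` times the next radius, so the expansion at `x` gives the recursive
  -- condition.
  · refine le_of_eq_of_le ?_ (H _ ((hpow (i + 1)).trans hκr))
    rw [pow_succ]
    field_simp
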